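/- Let $1\le k\le n/2$ and let $$\mathrm{Gr}(k,n)=\{Q\in\mathbb R^{n\times n}: Q^{\mathsf T}Q=I,\ Q^{\mathsf T}=Q,\ \operatorname{tr}Q=2k-n\}$$ be the Grassmannian in the involution model, a submanifold of $\mathbb R^{n\times n}$ with the induced Riemannian metric $\langle X,Y\rangle_Q=\operatorname{tr}(XY)$, norm $\lVert X\rVert_Q=\lVert X\rVert_{\mathsf F}$, and geodesic distance $d$ (the infimum of the lengths of curves). For $Q\in\mathrm{Gr}(k,n)$ let $\exp_Q:\mathrm T_Q\mathrm{Gr}(k,n)\to\mathrm{Gr}(k,n)$ be the Riemannian exponential map: $\exp_Q(X)=\gamma(1)$ for the geodesic $\gamma$ with $\gamma(0)=Q$, $\dot\gamma(0)=X$. Let the injectivity radius $r_Q$ be the supremum of all $r$ such that $\exp_Q$ is a diffeomorphism of the open ball $\mathbb B_r(0)\subseteq\mathrm T_Q\mathrm{Gr}(k,n)$ onto its image, and let the logarithmic map $\log_Q:\exp_Q(\mathbb B_{r_Q}(0))\to\mathbb B_{r_Q}(0)$ be the inverse of $\exp_Q$ on $\mathbb B_{r_Q}(0)$. Let $Q_0,Q_1\in\mathrm{Gr}(k,n)$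 with $d(Q_0,Q_1)<\sqrt2\,\pi$. Let $V_0,V_1\in\mathrm O(n)$ be such that $Q_i=V_iI_{k,n-k}V_i^{\mathsf T}$ for $i=0,1$, where $I_{k,n-k}=\operatorname{diag}(I_k,-I_{n-k})$, and let $$V_0^{\mathsf T}V_1=\begin{bmatrix}U&0\\0&V\end{bmatrix}\begin{bmatrix}\cos\Theta&\sin\Theta&0\\-\sin\Theta&\cos\Theta&0\\0&0&I_{n-2k}\end{bmatrix}\begin{bmatrix}W&0\\0&Z\end{bmatrix}^{\mathsf T}$$ be a CS decomposition, i.e. $U,W\in\mathrm O(k)$, $V,Z\in\mathrm O(n-k)$ and $\Theta=\operatorname{diag}(\theta_1,\dots,\theta_k)$ with all $\theta_i\in[0,\pi/2]$. Put $B=-2U[\Theta,0]V^{\mathsf T}\in\mathbb R^{k\times(n-k)}$. Then $Q_1$ lies in the domain of $\log_{Q_0}$ and $$\log_{Q_0}(Q_1)=V_0\begin{bmatrix}0&B\\B^{\mathsf T}&0\end{bmatrix}V_0^{\mathsf T}.$$ -/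

import Mathlib

open scoped Matrix ContDiff

-- Calculus on matrices is taken with respect to the Frobenius norm.
attribute [local instance] Matrix.frobeniusNormedAddCommGroup Matrix.frobeniusNormedSpace

noncomputable section

namespace Grassmann

/-- A map between arbitrary subsets of normed spaces is smooth when it extends, near every point
of its domain `S`, to a smooth map on an open subset of the ambient space. -/
def IsSmoothOn {E F : Type*} [NormedAddCommGroup E] [NormedSpace ℝ E]
    [NormedAddCommGroup F] [NormedSpace ℝ F] (f : E → F) (S : Set E) : Prop :=
  ∀ x ∈ S, ∃ U : Set E, IsOpen U ∧ x ∈ U ∧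
    ∃ g : E → F, ContDiffOn ℝ ∞ g U ∧ Set.EqOn g f (S ∩ U)

/-- `f` restricts to a diffeomorphism of `S` onto its image `f '' S`. -/
def IsDiffeoOn {E F : Type*} [NormedAddCommGroup E] [NormedSpace ℝ E]
    [NormedAddCommGroup F] [NormedSpace ℝ F] (f : E → F) (S : Set E) : Prop :=
  IsSmoothOn f S ∧ ∃ g : F → E, Set.LeftInvOn g f S ∧ IsSmoothOn g (f '' S)

/-- The involution model of the Grassmannian: symmetric orthogonal `n × n` matrices of
trace `2k - n`. -/
def Gr (k n : ℕ) : Set (Matrix (Fin n) (Fin n) ℝ) :=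
  {Q | Qᵀ * Q = 1 ∧ Qᵀ = Q ∧ Q.trace = 2 * (k : ℝ) - (n : ℝ)}

/-- The tangent space at `Q`: velocities at time `0` of smooth curves in `Gr k n` through `Q`. -/
def tangentSpace (k n : ℕ) (Q : Matrix (Fin n) (Fin n) ℝ) : Set (Matrix (Fin n) (Fin n) ℝ) :=
  {X | ∃ γ : ℝ → Matrix (Fin n) (Fin n) ℝ, ContDiff ℝ ∞ γ ∧ (∀ t, γ t ∈ Gr k n) ∧
    γ 0 = Q ∧ HasDerivAt γ X 0}

/-- The inner product `⟨X, Y⟩ = tr(Xᵀ Y)`. On tangent vectors of `Gr k n`, which are symmetric,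
it is the Riemannian metric `tr(X Y)`. -/
def metric {n : ℕ} (X Y : Matrix (Fin n) (Fin n) ℝ) : ℝ := (Xᵀ * Y).trace

/-- The Riemannian norm. -/
def rnorm {n : ℕ} (X : Matrix (Fin n) (Fin n) ℝ) : ℝ := Real.sqrt (metric X X)

/-- The geodesic (Riemannian) distance: the infimum of the lengths of `C¹` curves
`[0, 1] → Gr k n` from `Q₀` to `Q₁` (it is `∞` when there is no such curve). -/
def geodesicDist (k n : ℕ) (Q₀ Q₁ : Matrix (Fin n) (Fin n) ℝ) : ENNReal :=
  ⨅ (γ : ℝ → Matrix (Fin n) (Fin n) ℝ) (_ : ContDiffOn ℝ 1 γ (Set.Icc 0 1))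
    (_ : ∀ t ∈ Set.Icc (0 : ℝ) 1, γ t ∈ Gr k n) (_ : γ 0 = Q₀) (_ : γ 1 = Q₁),
    ENNReal.ofReal (∫ t in (0 : ℝ)..1, rnorm (derivWithin γ (Set.Icc 0 1) t))

/-- Geodesics of `Gr k n` as a Riemannian submanifold of the space of matrices: smooth curves in
`Gr k n` whose covariant acceleration, the tangential part of the second derivative,
vanishes identically. -/
def IsGeodesic (k n : ℕ) (γ : ℝ → Matrix (Fin n) (Fin n) ℝ) : Prop :=
  ContDiff ℝ ∞ γ ∧ (∀ t, γ t ∈ Gr k n) ∧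
    ∀ t, ∀ Y ∈ tangentSpace k n (γ t), metric (deriv (deriv γ) t) Y = 0

/-- The exponential map at `Q`: the point at time `1` of the geodesic emanating from `Q` with
initial velocity `X` (meaningful for `X` in the tangent space at `Q`). -/
def expMap (k n : ℕ) (Q X : Matrix (Fin n) (Fin n) ℝ) : Matrix (Fin n) (Fin n) ℝ :=
  Classical.epsilon fun P => ∃ γ : ℝ → Matrix (Fin n) (Fin n) ℝ,
    IsGeodesic k n γ ∧ γ 0 = Q ∧ HasDerivAt γ X 0 ∧ γ 1 = P

/-- The open ball of radius `r` about the origin of the tangent space at `Q`. -/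
def tangentBall (k n : ℕ) (Q : Matrix (Fin n) (Fin n) ℝ) (r : ENNReal) :
    Set (Matrix (Fin n) (Fin n) ℝ) :=
  {X | X ∈ tangentSpace k n Q ∧ ENNReal.ofReal (rnorm X) < r}

/-- The injectivity radius at `Q`: the supremum of the radii of the balls about the origin of the
tangent space on which the exponential map is a diffeomorphism onto its image. -/
def injRadius (k n : ℕ) (Q : Matrix (Fin n) (Fin n) ℝ) : ENNReal :=
  sSup {r | IsDiffeoOn (expMap k n Q) (tangentBall k n Q r)}

/-- The domain of the logarithmic map at `Q`. -/
def logDomain (k n : ℕ) (Q : Matrix (Fin n) (Fin n) ℝ) : Set (Matrix (Fin n) (Fin n) ℝ) :=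
  expMap k n Q '' tangentBall k n Q (injRadius k n Q)

/-- The logarithmic map at `Q`: the inverse of the exponential map restricted to the ball whose
radius is the injectivity radius (meaningful on `logDomain k n Q`). -/
def logMap (k n : ℕ) (Q : Matrix (Fin n) (Fin n) ℝ) :
    Matrix (Fin n) (Fin n) ℝ → Matrix (Fin n) (Fin n) ℝ :=
  Function.invFunOn (expMap k n Q) (tangentBall k n Q (injRadius k n Q))

/-- The `k × m` matrix `[diag(d), 0]` (for `k ≤ m`). -/
def rectDiag {k : ℕ} (m : ℕ) (d : Fin k → ℝ) : Matrix (Fin k) (Fin m) ℝ :=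
  Matrix.of fun i j => if (i : ℕ) = (j : ℕ) then d i else 0

/-- The matrix `I_{k,m} = diag(I_k, -I_m)`. -/
def signature (k m : ℕ) : Matrix (Fin k ⊕ Fin m) (Fin k ⊕ Fin m) ℝ :=
  Matrix.fromBlocks 1 0 0 (-1)

/-- The middle factor of the CS decomposition, for `k ≤ m`:
`[[cos Θ, sin Θ, 0], [-sin Θ, cos Θ, 0], [0, 0, I]]` with `Θ = diag(θ)` and blocks of sizes
`k`, `k`, `m - k`, the last two being grouped together. -/
def csMiddle {k : ℕ} (m : ℕ) (θ : Fin k → ℝ) : Matrix (Fin k ⊕ Fin m) (Fin k ⊕ Fin m) ℝ :=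
  Matrix.fromBlocks
    (Matrix.diagonal fun i => Real.cos (θ i))
    (rectDiag m fun i => Real.sin (θ i))
    (-(rectDiag m fun i => Real.sin (θ i))ᵀ)
    (Matrix.diagonal fun j => if h : (j : ℕ) < k then Real.cos (θ ⟨j, h⟩) else 1)

/-- `V` is an orthogonal `n × n` matrix with `Q = V I_{k,n-k} Vᵀ`. The columns of `V` are indexed
by `Fin k ⊕ Fin (n - k)`, according to their grouping as `1`- and `(-1)`-eigenvectors. -/
def IsEigendecomposition {k n : ℕ} (Q : Matrix (Fin n) (Fin n) ℝ)
    (V : Matrix (Fin n) (Fin k ⊕ Fin (n - k)) ℝ) : Prop :=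
  Vᵀ * V = 1 ∧ V * Vᵀ = 1 ∧ Q = V * signature k (n - k) * Vᵀ

end Grassmann

end

/-! ### Smooth dependence of integrals over `[0, 1]` on a parameter. -/

namespace ParametricIntegral

open Set Filter Topology MeasureTheory Interval

universe u

variable {E F : Type u} [NormedAddCommGroup E] [NormedSpace ℝ E]
  [NormedAddCommGroup F] [NormedSpace ℝ F]

/-! For a tangent vector X at Q, that is, X symmetric with XQ = -QX, the geodesic is t ↦ exp(tXQ)Q
(`IsGeodesic.eq_exp`). Inverting the exponential map at Q therefore means taking a matrix logarithm
of PQ. The logarithm used is `plog`, the integral of (M-1)(1+t(M-1))⁻¹. It is smooth on the open set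
`domain` of those M for which the segment from 1 to M is invertible throughout.

An orthogonal M = exp(XQ) lies in `domain` when all eigenvalues of X are below π in absolute value,
and it does not when one of them is ±π. Since Q maps the c-eigenspace of X to the (-c)-eigenspace,
nonzero eigenvalues come in pairs ±c, so 2c² ≤ ‖X‖² and ‖X‖ < √2π suffices. This shows that the
injectivity radius is at least √2π (`isDiffeoOn_expMap`), and this lower bound is all that is
needed.

To realise Q₁ as the exponential of a short vector, take a curve γ from Q₀ of length below √2π. A
Gauss lemma (`exists_hasDerivAt_trace_plog_sq`) shows that ‖plog(γQ₀)‖ grows no faster than arc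
length, and compactness prevents γQ₀ from leaving `domain` (`exists_isTangent_of_length_lt`). No
Hopf–Rinow theorem or minimising geodesic is involved.

The CS decomposition gives a second preimage of Q₁, with eigenvalues at most π in absolute value
(`csTangent`). The short preimage already shows that Q₁Q₀ lies in `domain`, which rules out the
value π. Both generators then equal plog(Q₁Q₀), so the two vectors agree (`eq_csTangent`). -/

theorem hasFDerivAt_fst {f : E → ℝ → F} {x : E} {t : ℝ}
    (h : ContDiffAt ℝ ∞ (fun p : E × ℝ => f p.1 p.2) (x, t)) :
    HasFDerivAt (fun y => f y t)
      ((fderiv ℝ (fun p : E × ℝ => f p.1 p.2) (x, t)).comp (ContinuousLinearMap.inl ℝ E ℝ)) x :=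
  HasFDerivAt.comp (f := fun y => (y, t)) x (h.differentiableAt (by simp)).hasFDerivAt
    (hasFDerivAt_prodMk_left x t)

theorem contDiffAt_fderiv_fst {f : E → ℝ → F} {x : E} {t : ℝ}
    (h : ContDiffAt ℝ ∞ (fun p : E × ℝ => f p.1 p.2) (x, t)) :
    ContDiffAt ℝ ∞ (fun p : E × ℝ =>
      (fderiv ℝ (fun p : E × ℝ => f p.1 p.2) p).comp (ContinuousLinearMap.inl ℝ E ℝ)) (x, t) := by
  have h1 : ContDiffAt ℝ ∞ (fderiv ℝ (fun p : E × ℝ => f p.1 p.2)) (x, t) :=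
    h.fderiv_right (by simp)
  exact h1.clm_comp contDiffAt_const

theorem continuousOn_snd {f : E → ℝ → F} {x : E}
    (h : ∀ t ∈ Icc (0 : ℝ) 1, ContDiffAt ℝ ∞ (fun p : E × ℝ => f p.1 p.2) (x, t)) :
    ContinuousOn (f x) (Icc 0 1) := fun t ht =>
  (ContinuousAt.comp (f := fun s : ℝ => (x, s)) (h t ht).continuousAt
    (by fun_prop)).continuousWithinAt

theorem hasFDerivAt_integral {f : E → ℝ → F} {s : Set E} (hs : IsOpen s)
    (h : ∀ x ∈ s, ∀ t ∈ Icc (0 : ℝ) 1, ContDiffAt ℝ ∞ (fun p : E × ℝ => f p.1 p.2) (x, t))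
    {x : E} (hx : x ∈ s) :
    HasFDerivAt (fun y => ∫ t in (0 : ℝ)..1, f y t)
      (∫ t in (0 : ℝ)..1, (fderiv ℝ (fun p : E × ℝ => f p.1 p.2) (x, t)).comp
        (ContinuousLinearMap.inl ℝ E ℝ)) x := by
  set D : E → ℝ → E →L[ℝ] F := fun y t =>
    (fderiv ℝ (fun p : E × ℝ => f p.1 p.2) (y, t)).comp (ContinuousLinearMap.inl ℝ E ℝ) with hD
  have hDc : ∀ y ∈ s, ContinuousOn (D y) (Icc 0 1) := fun y hy =>
    continuousOn_snd fun t ht => contDiffAt_fderiv_fst (h y hy t ht)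
  obtain ⟨C, hC⟩ := isCompact_Icc.exists_bound_of_continuousOn (hDc x hx)
  -- Domination needs one bound for all t and all y near x. Compactness of `[0, 1]` spreads the
  -- bound at x to a neighbourhood, and the extra 1 makes the inequality strict and hence open.
  have hev : ∀ᶠ y in 𝓝 x, ∀ t ∈ Icc (0 : ℝ) 1, ‖D y t‖ < C + 1 := by
    refine isCompact_Icc.eventually_forall_of_forall_eventually fun t ht => ?_
    have hc : ContinuousAt (fun p : E × ℝ => ‖D p.1 p.2‖) (x, t) :=
      (contDiffAt_fderiv_fst (h x hx t ht)).continuousAt.norm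
    exact hc.eventually_lt continuousAt_const ((hC t ht).trans_lt (by simp))
  have hIoc : Ι (0 : ℝ) 1 ⊆ Icc 0 1 := by
    rw [uIoc_of_le zero_le_one]; exact Ioc_subset_Icc_self
  have hmeas : ∀ {G : Type u} [NormedAddCommGroup G] {g : ℝ → G}, ContinuousOn g (Icc 0 1) →
      AEStronglyMeasurable g (volume.restrict (Ι (0 : ℝ) 1)) := fun hg =>
    (hg.mono hIoc).aestronglyMeasurable measurableSet_uIoc
  refine intervalIntegral.hasFDerivAt_integral_of_dominated_of_fderiv_le (F' := D)
    (bound := fun _ => C + 1) (s := {y | y ∈ s ∧ ∀ t ∈ Icc (0 : ℝ) 1, ‖D y t‖ < C + 1})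
    ((hs.mem_nhds hx |> fun h => Filter.Eventually.and h hev)) ?_ ?_ (hmeas (hDc x hx)) ?_
    (by simp) ?_
  · filter_upwards [hs.mem_nhds hx] with y hy using hmeas (continuousOn_snd (h y hy))
  · refine ContinuousOn.intervalIntegrable ?_
    rw [uIcc_of_le zero_le_one]
    exact continuousOn_snd (h x hx)
  · exact ae_of_all _ fun t ht y hy => (hy.2 t (hIoc ht)).le
  · exact ae_of_all _ fun t ht y hy => hasFDerivAt_fst (h y hy.1 t (hIoc ht))

/-- The derivative is again such an integral, with values in `E →L[ℝ] F`. The induction therefore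
quantifies over the codomain, and `E` and `F` share a universe so that it can be reapplied. -/
theorem contDiffOn_integral_nat (n : ℕ) : ∀ {F : Type u} [NormedAddCommGroup F] [NormedSpace ℝ F]
    {f : E → ℝ → F} {s : Set E} (_ : IsOpen s)
    (_ : ∀ x ∈ s, ∀ t ∈ Icc (0 : ℝ) 1, ContDiffAt ℝ ∞ (fun p : E × ℝ => f p.1 p.2) (x, t)),
    ContDiffOn ℝ n (fun y => ∫ t in (0 : ℝ)..1, f y t) s := by
  induction n with
  | zero =>
    intro F _ _ f s hs h
    exact contDiffOn_zero.2 fun x hx => (hasFDerivAt_integral hs h hx).continuousAt.continuousWithinAt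
  | succ n ih =>
    intro F _ _ f s hs h
    push_cast
    rw [contDiffOn_succ_iff_fderiv_of_isOpen hs]
    refine ⟨fun x hx => (hasFDerivAt_integral hs h hx).differentiableAt.differentiableWithinAt,
      by simp, ?_⟩
    refine (ih (f := fun y t => (fderiv ℝ (fun p : E × ℝ => f p.1 p.2) (y, t)).comp
      (ContinuousLinearMap.inl ℝ E ℝ)) hs fun x hx t ht =>
        contDiffAt_fderiv_fst (h x hx t ht)).congr fun x hx => ?_
    exact (hasFDerivAt_integral hs h hx).fderiv

theorem contDiffOn_integral {f : E → ℝ → F} {s : Set E} (hs : IsOpen s)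
    (h : ∀ x ∈ s, ∀ t ∈ Icc (0 : ℝ) 1, ContDiffAt ℝ ∞ (fun p : E × ℝ => f p.1 p.2) (x, t)) :
    ContDiffOn ℝ ∞ (fun y => ∫ t in (0 : ℝ)..1, f y t) s :=
  contDiffOn_infty.2 fun n => contDiffOn_integral_nat n hs h

end ParametricIntegral

/-! ### The principal logarithm in a real Banach algebra. -/

namespace PrincipalLog

open Set Filter Topology MeasureTheory NormedSpace

universe u

theorem commute_ringInverse {R : Type*} [Ring R] {a b : R} (h : Commute a b) : Commute a (Ring.inverse b) := by
  by_cases hb : IsUnit b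
  · obtain ⟨u, rfl⟩ := hb
    rw [Ring.inverse_unit]
    exact h.units_inv_right
  · rw [Ring.inverse_non_unit _ hb]
    exact Commute.zero_right a

variable {A : Type u} [NormedRing A] [NormedAlgebra ℝ A]

/-- The resolvent-type family `(1 + t (M - 1))⁻¹`. -/
noncomputable def resolvent (M : A) (t : ℝ) : A := Ring.inverse (1 + t • (M - 1))

/-- The elements `M` such that the segment from `1` to `M` consists of invertible elements. -/
def domain (A : Type u) [NormedRing A] [NormedAlgebra ℝ A] : Set A :=
  {M | ∀ t ∈ Icc (0 : ℝ) 1, IsUnit (1 + t • (M - 1))}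

/-- The principal logarithm in a Banach algebra. -/
noncomputable def plog (M : A) : A := ∫ t in (0 : ℝ)..1, (M - 1) * resolvent M t

theorem commute_segment {a M : A} (h : Commute a M) (t : ℝ) : Commute a (1 + t • (M - 1)) :=
  (Commute.one_right a).add_right ((h.sub_right (Commute.one_right a)).smul_right t)

theorem commute_resolvent {a M : A} (h : Commute a M) (t : ℝ) : Commute a (resolvent M t) :=
  commute_ringInverse (commute_segment h t)

theorem segment_mul_resolvent {M : A} (hM : M ∈ domain A) {t : ℝ} (ht : t ∈ Icc (0 : ℝ) 1) :
    (1 + t • (M - 1)) * resolvent M t = 1 :=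
  Ring.mul_inverse_cancel _ (hM t ht)

theorem resolvent_mul_segment {M : A} (hM : M ∈ domain A) {t : ℝ} (ht : t ∈ Icc (0 : ℝ) 1) :
    resolvent M t * (1 + t • (M - 1)) = 1 :=
  Ring.inverse_mul_cancel _ (hM t ht)

theorem isUnit_of_mem_domain {M : A} (hM : M ∈ domain A) : IsUnit M := by
  simpa using hM 1 (by simp)

theorem one_mem_domain : (1 : A) ∈ domain A := fun t _ => by simp

theorem segment_mem_domain {M : A} (hM : M ∈ domain A) {r : ℝ} (hr : r ∈ Icc (0 : ℝ) 1) :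
    1 + r • (M - 1) ∈ domain A := fun t ht => by
  have h := hM (t * r) ⟨mul_nonneg ht.1 hr.1, mul_le_one₀ ht.2 hr.1 hr.2⟩
  rwa [add_sub_cancel_left, smul_smul]

theorem plog_one : plog (1 : A) = 0 := by simp [plog]

/-- The substitution t ↦ 1 - t reduces this to 1 + t(M⁻¹-1) = (1+(1-t)(M-1))M⁻¹. -/
theorem plog_inverse {M : A} (hM : M ∈ domain A) : plog (Ring.inverse M) = -plog M := by
  have hu := isUnit_of_mem_domain hM
  have h1 := intervalIntegral.integral_comp_sub_left (a := 0) (b := 1)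
    (fun t => (M - 1) * resolvent M t) 1
  simp only [sub_self, sub_zero] at h1
  rw [plog, plog, ← h1, ← intervalIntegral.integral_neg]
  refine intervalIntegral.integral_congr fun t ht => ?_
  rw [uIcc_of_le zero_le_one] at ht
  have ht' : 1 - t ∈ Icc (0 : ℝ) 1 := ⟨by linarith [ht.2], by linarith [ht.1]⟩
  have h2 : 1 + t • (Ring.inverse M - 1) = (1 + (1 - t) • (M - 1)) * Ring.inverse M := by
    simp only [add_mul, smul_mul_assoc, sub_mul, Ring.mul_inverse_cancel M hu, one_mul, smul_sub,
      sub_smul, one_smul]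
    abel
  have h3 : Ring.inverse M - 1 = -((M - 1) * Ring.inverse M) := by
    rw [sub_mul, Ring.mul_inverse_cancel M hu, one_mul, neg_sub]
  simp only [resolvent]
  rw [h2, Ring.inverse_mul (Or.inl (hM _ ht')), Ring.inverse_inverse hu, h3, neg_mul,
    mul_assoc, Ring.inverse_mul_cancel_left _ _ hu]

variable [CompleteSpace A]

theorem isOpen_domain : IsOpen (domain A) := by
  rw [isOpen_iff_mem_nhds]
  intro M hM
  refine isCompact_Icc.eventually_forall_of_forall_eventually (P := fun M t =>
    IsUnit (1 + t • (M - 1))) fun t ht => ?_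
  have hc : ContinuousAt (fun p : A × ℝ => 1 + p.2 • (p.1 - 1)) (M, t) := by fun_prop
  exact hc.eventually (Units.isOpen.mem_nhds (hM t ht))

theorem contDiffAt_resolvent {M : A} (hM : M ∈ domain A) {t : ℝ} (ht : t ∈ Icc (0 : ℝ) 1) :
    ContDiffAt ℝ ∞ (fun p : A × ℝ => resolvent p.1 p.2) (M, t) := by
  obtain ⟨u, hu⟩ := hM t ht
  have h1 : ContDiffAt ℝ ∞ (Ring.inverse : A → A) (1 + t • (M - 1)) :=
    hu ▸ contDiffAt_ringInverse ℝ u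
  exact ContDiffAt.comp (f := fun p : A × ℝ => 1 + p.2 • (p.1 - 1)) (M, t) h1 (by fun_prop)

theorem contDiffAt_integrand {M : A} (hM : M ∈ domain A) {t : ℝ} (ht : t ∈ Icc (0 : ℝ) 1) :
    ContDiffAt ℝ ∞ (fun p : A × ℝ => (p.1 - 1) * resolvent p.1 p.2) (M, t) :=
  ContDiffAt.mul (by fun_prop) (contDiffAt_resolvent hM ht)

theorem continuousOn_resolvent {M : A} (hM : M ∈ domain A) :
    ContinuousOn (resolvent M) (Icc 0 1) :=
  ParametricIntegral.continuousOn_snd fun _ ht => contDiffAt_resolvent hM ht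

theorem intervalIntegrable_of_continuousOn {B : Type*} [NormedAddCommGroup B] {f : ℝ → B}
    (hf : ContinuousOn f (Icc 0 1)) : IntervalIntegrable f volume 0 1 := by
  refine ContinuousOn.intervalIntegrable ?_
  rwa [uIcc_of_le zero_le_one]

theorem contDiffOn_plog : ContDiffOn ℝ ∞ (plog : A → A) (domain A) :=
  ParametricIntegral.contDiffOn_integral isOpen_domain fun _ hM _ ht => contDiffAt_integrand hM ht

theorem hasFDerivAt_resolvent {M : A} (hM : M ∈ domain A) {t : ℝ} (ht : t ∈ Icc (0 : ℝ) 1) :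
    HasFDerivAt (Ring.inverse : A → A)
      (-ContinuousLinearMap.mulLeftRight ℝ A (resolvent M t) (resolvent M t))
      (1 + t • (M - 1)) := by
  obtain ⟨u, hu⟩ := hM t ht
  have h := hasFDerivAt_ringInverse (𝕜 := ℝ) u
  rwa [← Ring.inverse_unit, hu] at h

/-- With R the resolvent, t(M-1)R = 1 - R. The product rule in direction H then gives HR - (1-R)HR =
RHR, with no commutativity assumed. -/
theorem hasFDerivAt_integrand {M : A} (hM : M ∈ domain A) {t : ℝ} (ht : t ∈ Icc (0 : ℝ) 1) :
    HasFDerivAt (fun N : A => (N - 1) * resolvent N t)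
      (ContinuousLinearMap.mulLeftRight ℝ A (resolvent M t) (resolvent M t)) M := by
  have h1 : HasFDerivAt (fun N : A => 1 + t • (N - 1)) (t • ContinuousLinearMap.id ℝ A) M :=
    (((hasFDerivAt_id M).sub_const 1).const_smul t).const_add 1
  have h2 : HasFDerivAt (fun N : A => resolvent N t) _ M :=
    (hasFDerivAt_resolvent hM ht).comp M h1
  refine (((hasFDerivAt_id M).sub_const 1).mul' h2).congr_fderiv ?_
  ext H
  have h3 := segment_mul_resolvent hM ht
  have h4 : (M - 1) * (t • resolvent M t) = 1 - resolvent M t := by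
    rw [add_mul, one_mul, smul_mul_assoc, ← mul_smul_comm] at h3
    exact eq_sub_of_add_eq' h3
  simp only [id, add_apply, smul_apply, smul_eq_mul,
    ContinuousLinearMap.comp_apply, neg_apply,
    ContinuousLinearMap.mulLeftRight_apply, ContinuousLinearMap.id_apply,
    MulOpposite.smul_eq_mul_unop, MulOpposite.unop_op]
  have h5 : (M - 1) * -(resolvent M t * t • H * resolvent M t)
      = -((M - 1) * (t • resolvent M t) * H * resolvent M t) := by
    simp [mul_assoc]
  rw [h5, h4]
  noncomm_ring

theorem continuousOn_mulLeftRight {M : A} (hM : M ∈ domain A) :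
    ContinuousOn (fun t => ContinuousLinearMap.mulLeftRight ℝ A (resolvent M t) (resolvent M t))
      (Icc 0 1) :=
  ((ContinuousLinearMap.mulLeftRight ℝ A).continuous.comp_continuousOn
    (continuousOn_resolvent hM)).clm_apply (continuousOn_resolvent hM)

theorem hasFDerivAt_plog {M : A} (hM : M ∈ domain A) :
    HasFDerivAt (plog : A → A) (∫ t in (0 : ℝ)..1,
      ContinuousLinearMap.mulLeftRight ℝ A (resolvent M t) (resolvent M t)) M := by
  refine (ParametricIntegral.hasFDerivAt_integral isOpen_domain
    (fun _ hM _ ht => contDiffAt_integrand hM ht) hM).congr_fderiv ?_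
  refine intervalIntegral.integral_congr fun t ht => ?_
  rw [uIcc_of_le zero_le_one] at ht
  exact (ParametricIntegral.hasFDerivAt_fst (f := fun N t => (N - 1) * resolvent N t)
    (contDiffAt_integrand hM ht)).unique (hasFDerivAt_integrand hM ht)

theorem hasDerivAt_plog_comp {c : ℝ → A} {c' : A} {t : ℝ} (hM : c t ∈ domain A)
    (hc : HasDerivAt c c' t) : HasDerivAt (fun s => plog (c s)) ((∫ s in (0 : ℝ)..1,
      ContinuousLinearMap.mulLeftRight ℝ A (resolvent (c t) s) (resolvent (c t) s)) c') t :=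
  (hasFDerivAt_plog hM).comp_hasDerivAt t hc

theorem integral_mulLeftRight_apply {M : A} (hM : M ∈ domain A) (H : A) :
    (∫ t in (0 : ℝ)..1, ContinuousLinearMap.mulLeftRight ℝ A (resolvent M t) (resolvent M t)) H
      = ∫ t in (0 : ℝ)..1, resolvent M t * H * resolvent M t := by
  rw [ContinuousLinearMap.intervalIntegral_apply
    (intervalIntegrable_of_continuousOn (continuousOn_mulLeftRight hM))]
  rfl

theorem hasDerivAt_smul_resolvent {M : A} (hM : M ∈ domain A) {t : ℝ}
    (ht : t ∈ Icc (0 : ℝ) 1) :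
    HasDerivAt (fun t : ℝ => t • resolvent M t) (resolvent M t * resolvent M t) t := by
  have h1 : HasDerivAt (fun t : ℝ => 1 + t • (M - 1)) ((1 : ℝ) • (M - 1)) t :=
    ((hasDerivAt_id t).smul_const (M - 1)).const_add 1
  have h2 : HasDerivAt (resolvent M) _ t := (hasFDerivAt_resolvent hM ht).comp_hasDerivAt t h1
  refine ((hasDerivAt_id t).smul h2).congr_deriv ?_
  have h3 := resolvent_mul_segment hM ht
  have h4 : resolvent M t * (M - 1) * (t • resolvent M t)
      = resolvent M t - resolvent M t * resolvent M t := by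
    have : t • (resolvent M t * (M - 1)) = 1 - resolvent M t := by
      rw [mul_add, mul_one, mul_smul_comm] at h3
      exact eq_sub_of_add_eq' h3
    rw [mul_smul_comm, ← smul_mul_assoc, this, sub_mul, one_mul]
  simp only [id, one_smul, neg_apply, ContinuousLinearMap.mulLeftRight_apply,
    smul_neg]
  rw [← mul_smul_comm, h4]
  abel

/-- The integrand has the antiderivative tR, where R is the resolvent. -/
theorem integral_resolvent_sq {M : A} (hM : M ∈ domain A) :
    ∫ t in (0 : ℝ)..1, resolvent M t * resolvent M t = Ring.inverse M := by
  rw [intervalIntegral.integral_eq_sub_of_hasDerivAt (f := fun t : ℝ => t • resolvent M t)]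
  · simp [resolvent]
  · intro t ht
    rw [uIcc_of_le zero_le_one] at ht
    exact hasDerivAt_smul_resolvent hM ht
  · exact intervalIntegrable_of_continuousOn
      ((continuousOn_resolvent hM).mul (continuousOn_resolvent hM))

theorem plog_deriv_of_commute {M H : A} (hM : M ∈ domain A) (h : Commute H M) :
    (∫ t in (0 : ℝ)..1, ContinuousLinearMap.mulLeftRight ℝ A (resolvent M t) (resolvent M t)) H
      = H * Ring.inverse M := by
  have h1 := (ContinuousLinearMap.mul ℝ A H).intervalIntegral_comp_comm
    (intervalIntegrable_of_continuousOn
      ((continuousOn_resolvent hM).mul (continuousOn_resolvent hM)) :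
      IntervalIntegrable (fun t => resolvent M t * resolvent M t) volume 0 1)
  simp only [ContinuousLinearMap.mul_apply'] at h1
  rw [integral_mulLeftRight_apply hM, ← integral_resolvent_sq hM, ← h1]
  refine intervalIntegral.integral_congr fun t _ => ?_
  simp only [← (commute_resolvent h t).eq, mul_assoc]

theorem commute_plog {a M : A} (hM : M ∈ domain A) (h : Commute a M) : Commute a (plog M) := by
  have hi : IntervalIntegrable (fun t => (M - 1) * resolvent M t) volume 0 1 :=
    intervalIntegrable_of_continuousOn (continuousOn_const.mul (continuousOn_resolvent hM))
  have h1 := (ContinuousLinearMap.mul ℝ A a).intervalIntegral_comp_comm hi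
  have h2 := ((ContinuousLinearMap.mul ℝ A).flip a).intervalIntegral_comp_comm hi
  simp only [ContinuousLinearMap.mul_apply', ContinuousLinearMap.flip_apply] at h1 h2
  rw [commute_iff_eq, plog, ← h1, ← h2]
  refine intervalIntegral.integral_congr fun t _ => ?_
  exact ((h.sub_right (Commute.one_right a)).mul_right (commute_resolvent h t)).eq

/-- Commutation allows exp(c(s)) to be factored as exp(c(r)) exp(c(s)-c(r)), so only the derivative
of exp at 0 is needed. -/
theorem hasDerivAt_exp_of_commute {c : ℝ → A} {c' : A} {r : ℝ} (hc : HasDerivAt c c' r)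
    (hcomm : ∀ᶠ s in 𝓝 r, Commute (c r) (c s)) :
    HasDerivAt (fun s => exp (c s)) (exp (c r) * c') r := by
  let _ : NormedAlgebra ℚ A := NormedAlgebra.restrictScalars ℚ ℝ A
  have h1 : (fun s => exp (c s)) =ᶠ[𝓝 r] fun s => exp (c r) * exp (c s - c r) := by
    filter_upwards [hcomm] with s hs
    rw [← exp_add_of_commute (hs.sub_right (Commute.refl _)), add_sub_cancel]
  refine HasDerivAt.congr_of_eventuallyEq ?_ h1
  have h2 : HasFDerivAt (exp : A → A) (1 : A →L[ℝ] A) (c r - c r) := by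
    rw [sub_self]; exact hasFDerivAt_exp_zero
  exact (h2.comp_hasDerivAt r (hc.sub_const (c r))).const_mul (exp (c r))

theorem exp_neg_mul_exp (x : A) : exp (-x) * exp x = 1 := by
  let _ : NormedAlgebra ℚ A := NormedAlgebra.restrictScalars ℚ ℝ A
  rw [← exp_add_of_commute (Commute.refl x).neg_left, neg_add_cancel, exp_zero]

theorem exp_mul_exp_neg (x : A) : exp x * exp (-x) = 1 := by
  simpa using exp_neg_mul_exp (-x)

theorem eq_of_hasDerivAt_zero {B : Type*} [NormedAddCommGroup B] [NormedSpace ℝ B] {f : ℝ → B}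
    (h : ∀ t ∈ Icc (0 : ℝ) 1, HasDerivAt f 0 t) : f 1 = f 0 :=
  constant_of_has_deriv_right_zero (fun t ht => (h t ht).continuousAt.continuousWithinAt)
    (fun t ht => (h t (Ico_subset_Icc_self ht)).hasDerivWithinAt) 1 (by simp)

theorem exp_plog {M : A} (hM : M ∈ domain A) : exp (plog M) = M := by
  set c : ℝ → A := fun r => plog (1 + r • (M - 1)) with hc
  have hseg : ∀ r : ℝ, HasDerivAt (fun r : ℝ => 1 + r • (M - 1)) (M - 1) r := fun r => by
    simpa using ((hasDerivAt_id r).smul_const (M - 1)).const_add 1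
  have hcomm : ∀ r : ℝ, Commute (M - 1) (1 + r • (M - 1)) := fun r =>
    commute_segment ((Commute.refl M).sub_left (Commute.one_left M)) r
  have hcd : ∀ r ∈ Icc (0 : ℝ) 1,
      HasDerivAt c ((M - 1) * Ring.inverse (1 + r • (M - 1))) r := fun r hr => by
    have h := (hasFDerivAt_plog (segment_mem_domain hM hr)).comp_hasDerivAt r (hseg r)
    rwa [plog_deriv_of_commute (segment_mem_domain hM hr) (hcomm r)] at h
  -- Along the segment from 1 to M everything commutes, so c' = (M-1)(1+r(M-1))⁻¹ and the product
  -- below is constant.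
  have key : ∀ r ∈ Icc (0 : ℝ) 1,
      HasDerivAt (fun r => exp (-c r) * (1 + r • (M - 1))) 0 r := by
    intro r hr
    have hMr := segment_mem_domain hM hr
    have hev : ∀ᶠ s in 𝓝 r, Commute (-c r) (-c s) := by
      filter_upwards [(hseg r).continuousAt.eventually (isOpen_domain.mem_nhds hMr)] with s hs
      have h1 : Commute (1 + s • (M - 1)) (1 + r • (M - 1)) :=
        commute_segment (commute_segment (Commute.refl M) s).symm r
      exact (commute_plog hs (commute_plog hMr h1).symm).neg_left.neg_right
    refine ((hasDerivAt_exp_of_commute (hcd r hr).neg hev).mul (hseg r)).congr_deriv ?_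
    rw [mul_neg, neg_mul, mul_assoc, mul_assoc,
      Ring.inverse_mul_cancel _ (isUnit_of_mem_domain hMr), mul_one, neg_add_cancel]
  have h := eq_of_hasDerivAt_zero key
  simp only [hc, zero_smul, add_zero, plog_one, neg_zero, exp_zero, one_smul, add_sub_cancel,
    mul_one] at h
  calc exp (plog M) = exp (plog M) * (exp (-plog M) * M) := by rw [h, mul_one]
    _ = M := by rw [← mul_assoc, exp_mul_exp_neg, one_mul]

/-- While the path exp(sΩ) stays in `domain`, its logarithm has derivative Ω. The whole path is
required, since the endpoint alone does not determine the branch. -/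
theorem plog_exp {Ω : A} (h : ∀ s ∈ Icc (0 : ℝ) 1, exp (s • Ω) ∈ domain A) :
    plog (exp Ω) = Ω := by
  have key : ∀ s ∈ Icc (0 : ℝ) 1, HasDerivAt (fun s : ℝ => plog (exp (s • Ω)) - s • Ω) 0 s := by
    intro s hs
    have h1 : HasDerivAt (fun s : ℝ => exp (s • Ω)) (Ω * exp (s • Ω)) s :=
      hasDerivAt_exp_smul_const' Ω s
    have hcomm : Commute Ω (exp (s • Ω)) := (Commute.refl Ω).smul_right s |>.exp_right
    refine (((hasFDerivAt_plog (h s hs)).comp_hasDerivAt s h1).sub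
      ((hasDerivAt_id s).smul_const Ω)).congr_deriv ?_
    rw [plog_deriv_of_commute (h s hs) (hcomm.mul_left (Commute.refl _)),
      Ring.mul_inverse_cancel_right _ _ (isUnit_of_mem_domain (h s hs)), one_smul, sub_self]
  have := eq_of_hasDerivAt_zero key
  simpa [plog_one, sub_eq_zero] using this

/-- Since plog M commutes with the resolvent R, cyclicity turns RHR into R²H under the trace, and R²
integrates to M⁻¹. Thus, paired with plog M, the derivative behaves as though H commuted with M.
This is the core of the Gauss lemma. -/
theorem tracial_mul_plog_deriv {M : A} (hM : M ∈ domain A) (τ : A →L[ℝ] ℝ)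
    (hτ : ∀ a b, τ (a * b) = τ (b * a)) (H : A) :
    τ (plog M * (∫ t in (0 : ℝ)..1,
      ContinuousLinearMap.mulLeftRight ℝ A (resolvent M t) (resolvent M t)) H)
      = τ (plog M * Ring.inverse M * H) := by
  have hc := continuousOn_resolvent hM
  have h1 := (τ.comp (ContinuousLinearMap.mul ℝ A (plog M))).intervalIntegral_comp_comm
    (intervalIntegrable_of_continuousOn ((hc.mul continuousOn_const).mul hc) :
      IntervalIntegrable (fun t => resolvent M t * H * resolvent M t) volume 0 1)
  have h2 := (τ.comp ((ContinuousLinearMap.mulLeftRight ℝ A (plog M) H))).intervalIntegral_comp_comm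
    (intervalIntegrable_of_continuousOn (hc.mul hc) :
      IntervalIntegrable (fun t => resolvent M t * resolvent M t) volume 0 1)
  simp only [ContinuousLinearMap.comp_apply, ContinuousLinearMap.mul_apply',
    ContinuousLinearMap.mulLeftRight_apply] at h1 h2
  rw [integral_mulLeftRight_apply hM, ← integral_resolvent_sq hM, ← h1, ← h2]
  refine intervalIntegral.integral_congr fun t _ => ?_
  have h3 := (commute_resolvent (commute_plog hM (Commute.refl M)).symm t).eq
  calc τ (plog M * (resolvent M t * H * resolvent M t))
      = τ (plog M * resolvent M t * H * resolvent M t) := by simp only [mul_assoc]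
    _ = τ (resolvent M t * (plog M * resolvent M t * H)) := hτ _ _
    _ = τ (plog M * (resolvent M t * resolvent M t) * H) := by
      simp only [← mul_assoc]; rw [h3]

/-- The logarithm is equivariant under linear maps that are multiplicative on commuting pairs. -/
theorem map_plog {M : A} (hM : M ∈ domain A) (ψ : A →L[ℝ] A) (h1 : ψ 1 = 1)
    (hmul : ∀ a b, Commute a b → ψ (a * b) = ψ a * ψ b) : ψ (plog M) = plog (ψ M) := by
  have hi : IntervalIntegrable (fun t => (M - 1) * resolvent M t) volume 0 1 :=
    intervalIntegrable_of_continuousOn (continuousOn_const.mul (continuousOn_resolvent hM))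
  rw [plog, plog, ← ψ.intervalIntegral_comp_comm hi]
  refine intervalIntegral.integral_congr fun t ht => ?_
  rw [uIcc_of_le zero_le_one] at ht
  have hcM := (Commute.refl M).sub_left (Commute.one_left M)
  simp only [hmul _ _ (commute_resolvent hcM t), map_sub, h1]
  congr 1
  have h2 : ψ (1 + t • (M - 1)) = 1 + t • (ψ M - 1) := by simp [h1]
  have hcs := commute_resolvent (commute_segment (Commute.refl M) t).symm t
  have h3 : (1 + t • (ψ M - 1)) * ψ (resolvent M t) = 1 := by
    rw [← h2, ← hmul _ _ hcs, segment_mul_resolvent hM ht, h1]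
  have h4 : ψ (resolvent M t) * (1 + t • (ψ M - 1)) = 1 := by
    rw [← h2, ← hmul _ _ hcs.symm, resolvent_mul_segment hM ht, h1]
  exact (Ring.inverse_unit (⟨_, _, h3, h4⟩ : Aˣ)).symm

end PrincipalLog

/-! ### Smoothness of exp, and the Frobenius inner product. -/

section MatrixCalculus

open Set Filter Topology NormedSpace

attribute [local instance] Matrix.frobeniusNormedRing Matrix.frobeniusNormedAlgebra

theorem contDiff_normedSpace_exp {A : Type*} [NormedRing A] [NormedAlgebra ℝ A] [CompleteSpace A] :
    ContDiff ℝ ∞ (exp : A → A) :=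
  contDiff_iff_contDiffAt.2 fun x => (exp_analytic (𝕂 := ℝ) x).contDiffAt

namespace Matrix

variable {m n : Type*} [Fintype m] [Fintype n]

theorem hasDerivAt_of_apply {f : ℝ → Matrix m n ℝ} {f' : Matrix m n ℝ} {t : ℝ}
    (h : ∀ i j, HasDerivAt (fun s => f s i j) (f' i j) t) : HasDerivAt f f' t := by
  have h1 : HasDerivAt (fun s => (fun i j => f s i j : m → n → ℝ)) (fun i j => f' i j) t :=
    hasDerivAt_pi.2 fun i => hasDerivAt_pi.2 fun j => h i j
  exact (LinearMap.toContinuousLinearMap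
    (Matrix.ofLinearEquiv ℝ : (m → n → ℝ) ≃ₗ[ℝ] Matrix m n ℝ).toLinearMap).hasFDerivAt.comp_hasDerivAt
      t h1

/-- Transposition as a continuous linear map. -/
noncomputable def transposeCLM (m n : Type*) [Fintype m] [Fintype n] :
    Matrix m n ℝ →L[ℝ] Matrix n m ℝ :=
  LinearMap.toContinuousLinearMap (Matrix.transposeLinearEquiv m n ℝ ℝ).toLinearMap

@[simp] theorem transposeCLM_apply (X : Matrix m n ℝ) : transposeCLM m n X = Xᵀ := rfl

/-- The trace as a continuous linear map. -/
noncomputable def traceCLM (n : Type*) [Fintype n] : Matrix n n ℝ →L[ℝ] ℝ :=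
  LinearMap.toContinuousLinearMap (Matrix.traceLinearMap n ℝ ℝ)

@[simp] theorem traceCLM_apply (X : Matrix n n ℝ) : traceCLM n X = X.trace := rfl

theorem norm_sq_eq_trace (X : Matrix m n ℝ) : ‖X‖ ^ 2 = (Xᵀ * X).trace := by
  rw [frobenius_norm_def, ← Real.sqrt_eq_rpow, Real.sq_sqrt (by positivity), Matrix.trace]
  simp only [Matrix.diag_apply, Matrix.mul_apply, Matrix.transpose_apply]
  rw [Finset.sum_comm]
  refine Finset.sum_congr rfl fun i _ => Finset.sum_congr rfl fun j _ => ?_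
  simp [sq]

theorem trace_transpose_mul_le (X Y : Matrix m n ℝ) : (Xᵀ * Y).trace ≤ ‖X‖ * ‖Y‖ := by
  have h : ∀ Z : Matrix m n ℝ, ‖Z‖ = Real.sqrt (∑ p : n × m, Z p.2 p.1 ^ 2) := fun Z => by
    rw [← Real.sqrt_sq (norm_nonneg Z), norm_sq_eq_trace, Matrix.trace, Fintype.sum_prod_type]
    simp [Matrix.mul_apply, sq]
  rw [h X, h Y, Matrix.trace]
  refine le_trans (le_of_eq ?_) (Real.sum_mul_le_sqrt_mul_sqrt Finset.univ _ _)
  simp [Fintype.sum_prod_type, Matrix.mul_apply]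

end Matrix

end MatrixCalculus

/-! ### Tangent spaces, geodesics and the exponential map. -/

namespace Grassmann

open Set Filter Topology NormedSpace Matrix

attribute [local instance] Matrix.frobeniusNormedRing Matrix.frobeniusNormedAlgebra

variable {k n : ℕ} {Q X Y : Matrix (Fin n) (Fin n) ℝ}

theorem exp_neg_mul_exp (A : Matrix (Fin n) (Fin n) ℝ) : exp (-A) * exp A = 1 :=
  PrincipalLog.exp_neg_mul_exp A

theorem exp_mul_exp_neg (A : Matrix (Fin n) (Fin n) ℝ) : exp A * exp (-A) = 1 :=
  PrincipalLog.exp_mul_exp_neg A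

theorem rnorm_eq_norm (X : Matrix (Fin n) (Fin n) ℝ) : rnorm X = ‖X‖ := by
  rw [rnorm, metric, ← norm_sq_eq_trace, Real.sqrt_sq (norm_nonneg X)]

theorem mul_self_of_mem_Gr (hQ : Q ∈ Gr k n) : Q * Q = 1 := by
  have := hQ.1
  rwa [hQ.2.1] at this

/-- The symmetric matrices anticommuting with `Q`. -/
def IsTangent (Q X : Matrix (Fin n) (Fin n) ℝ) : Prop := Xᵀ = X ∧ X * Q = -(Q * X)

theorem generator_mul (hQ : Q * Q = 1) : X * Q * Q = X := by rw [mul_assoc, hQ, mul_one]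

theorem IsTangent.generator_anticomm (hX : IsTangent Q X) : X * Q * Q = -(Q * (X * Q)) := by
  rw [hX.2, neg_mul, mul_assoc Q X Q, hX.2]

theorem IsTangent.transpose_generator (hQ : Qᵀ = Q) (hX : IsTangent Q X) :
    (X * Q)ᵀ = -(X * Q) := by
  rw [transpose_mul, hQ, hX.1, hX.2, neg_neg]

theorem IsTangent.smul (hX : IsTangent Q X) (t : ℝ) : IsTangent Q (t • X) :=
  ⟨by rw [transpose_smul, hX.1], by rw [smul_mul_assoc, hX.2, mul_smul_comm, smul_neg]⟩

theorem exp_mul_of_anticomm {A Q : Matrix (Fin n) (Fin n) ℝ} (h : A * Q = -(Q * A)) :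
    exp A * Q = Q * exp (-A) := by
  let _ : NormedAlgebra ℚ (Matrix (Fin n) (Fin n) ℝ) := NormedAlgebra.restrictScalars ℚ ℝ _
  have : SemiconjBy Q (-A) A := by rw [SemiconjBy, h, mul_neg]
  exact this.exp_right.symm

theorem transpose_exp_of_skew {A : Matrix (Fin n) (Fin n) ℝ} (h : Aᵀ = -A) :
    (exp A)ᵀ = exp (-A) := by rw [← Matrix.exp_transpose, h]

theorem IsTangent.exp_mem_Gr (hQ : Q ∈ Gr k n) (hX : IsTangent Q X) :
    exp (X * Q) * Q ∈ Gr k n := by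
  have hQQ := mul_self_of_mem_Gr hQ
  have hs := transpose_exp_of_skew (hX.transpose_generator hQ.2.1)
  have hsym : (exp (X * Q) * Q)ᵀ = exp (X * Q) * Q := by
    rw [transpose_mul, hs, hQ.2.1, exp_mul_of_anticomm hX.generator_anticomm]
  refine ⟨?_, hsym, ?_⟩
  · rw [transpose_mul, hs, hQ.2.1, mul_assoc, ← mul_assoc (exp (-(X * Q))),
      exp_neg_mul_exp, one_mul, hQQ]
  -- Splitting the exponential into two halves gives exp(XQ)Q = exp(XQ/2) Q exp(-XQ/2), a conjugate
  -- of Q, so the trace is unchanged.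
  · have h2 : X * Q = (2⁻¹ : ℝ) • (X * Q) + (2⁻¹ : ℝ) • (X * Q) := by
      rw [← add_smul]; norm_num
    have h3 := (hX.smul 2⁻¹).generator_anticomm
    rw [smul_mul_assoc] at h3
    rw [h2, Matrix.exp_add_of_commute _ _ (Commute.refl _), mul_assoc, exp_mul_of_anticomm h3,
      Matrix.trace_mul_comm, mul_assoc, exp_neg_mul_exp, mul_one, hQ.2.2]

theorem isTangent_of_mem_tangentSpace (h : X ∈ tangentSpace k n Q) : IsTangent Q X := by
  obtain ⟨γ, -, hγ, rfl, hX⟩ := h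
  constructor
  · have h1 : HasDerivAt (fun t => (γ t)ᵀ) Xᵀ 0 :=
      (transposeCLM (Fin n) (Fin n)).hasFDerivAt.comp_hasDerivAt 0 hX
    simp only [fun t => (hγ t).2.1] at h1
    exact h1.unique hX
  · have h1 := hX.mul hX
    have h2 : (γ * γ) = fun _ => 1 := funext fun t => mul_self_of_mem_Gr (hγ t)
    rw [h2] at h1
    exact eq_neg_of_add_eq_zero_left (h1.unique (hasDerivAt_const _ _))

theorem contDiff_exp_smul_mul (Ω Q : Matrix (Fin n) (Fin n) ℝ) :
    ContDiff ℝ ∞ fun t : ℝ => exp (t • Ω) * Q :=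
  (contDiff_normedSpace_exp.comp (contDiff_id.smul contDiff_const)).mul contDiff_const

theorem hasDerivAt_exp_smul_mul (Ω Q : Matrix (Fin n) (Fin n) ℝ) (t : ℝ) :
    HasDerivAt (fun t : ℝ => exp (t • Ω) * Q) (Ω * (exp (t • Ω) * Q)) t := by
  rw [← mul_assoc]
  exact (hasDerivAt_exp_smul_const' Ω t).mul_const Q

theorem IsTangent.curve_mem_Gr (hQ : Q ∈ Gr k n) (hX : IsTangent Q X) (t : ℝ) :
    exp (t • (X * Q)) * Q ∈ Gr k n := by
  rw [← smul_mul_assoc]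
  exact (hX.smul t).exp_mem_Gr hQ

theorem hasDerivAt_curve_zero (hQ : Q ∈ Gr k n) :
    HasDerivAt (fun t : ℝ => exp (t • (X * Q)) * Q) X 0 := by
  have h := hasDerivAt_exp_smul_mul (X * Q) Q 0
  rwa [zero_smul, exp_zero, one_mul, generator_mul (mul_self_of_mem_Gr hQ)] at h

theorem mem_tangentSpace_iff (hQ : Q ∈ Gr k n) : X ∈ tangentSpace k n Q ↔ IsTangent Q X := by
  refine ⟨isTangent_of_mem_tangentSpace, fun hX => ⟨fun t => exp (t • (X * Q)) * Q,
    contDiff_exp_smul_mul _ _, hX.curve_mem_Gr hQ, by simp [exp_zero], hasDerivAt_curve_zero hQ⟩⟩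

/-- Conjugation by P preserves the trace, fixes N and negates Y. Hence matrices commuting with P are
normal to the Grassmannian at P. -/
theorem trace_mul_eq_zero {P N : Matrix (Fin n) (Fin n) ℝ} (hP : P * P = 1)
    (hN : N * P = P * N) (hY : Y * P = -(P * Y)) : (N * Y).trace = 0 := by
  have h1 : (N * Y).trace = -(N * Y).trace := by
    calc (N * Y).trace = (N * (P * P) * Y).trace := by rw [hP, mul_one]
      _ = (P * (N * P * Y)).trace := by rw [← mul_assoc, hN, mul_assoc P, mul_assoc P, hN]
      _ = (N * (P * Y) * P).trace := by rw [Matrix.trace_mul_comm, mul_assoc N P Y]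
      _ = -(N * Y).trace := by
        have h2 : P * Y * P = -Y := by rw [mul_assoc, hY, mul_neg, ← mul_assoc, hP, one_mul]
        rw [mul_assoc, h2, mul_neg, trace_neg]
  linarith

theorem deriv_curve (Ω Q : Matrix (Fin n) (Fin n) ℝ) (t : ℝ) :
    deriv (deriv fun t : ℝ => exp (t • Ω) * Q) t = Ω * (Ω * (exp (t • Ω) * Q)) := by
  have h1 : deriv (fun t : ℝ => exp (t • Ω) * Q) = fun t => Ω * (exp (t • Ω) * Q) :=
    funext fun t => (hasDerivAt_exp_smul_mul Ω Q t).deriv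
  rw [h1]
  exact ((hasDerivAt_exp_smul_mul Ω Q t).const_mul Ω).deriv

theorem IsTangent.isGeodesic (hQ : Q ∈ Gr k n) (hX : IsTangent Q X) :
    IsGeodesic k n fun t : ℝ => exp (t • (X * Q)) * Q := by
  refine ⟨contDiff_exp_smul_mul _ _, hX.curve_mem_Gr hQ, fun t Y hY => ?_⟩
  let _ : NormedAlgebra ℚ (Matrix (Fin n) (Fin n) ℝ) := NormedAlgebra.restrictScalars ℚ ℝ _
  have hY := isTangent_of_mem_tangentSpace hY
  have hP := hX.curve_mem_Gr hQ t
  rw [deriv_curve, metric]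
  set Ω := X * Q
  have hΩ : Ω * (exp (t • Ω) * Q) = -(exp (t • Ω) * Q * Ω) := by
    rw [← mul_assoc, (((Commute.refl Ω).smul_right t).exp_right).eq, mul_assoc,
      hX.generator_anticomm, mul_neg, mul_assoc]
  refine trace_mul_eq_zero (mul_self_of_mem_Gr hP) ?_ hY.2
  generalize exp (t • Ω) * Q = P at hP hΩ
  rw [transpose_mul, transpose_mul, hP.2.1, hX.transpose_generator hQ.2.1]
  simp only [mul_neg, neg_mul, neg_neg]
  calc P * Ω * Ω * P = P * (Ω * (Ω * P)) := by simp only [mul_assoc]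
    _ = P * (P * Ω * Ω) := by rw [hΩ, mul_neg, ← mul_assoc, hΩ, neg_mul, neg_neg]

theorem eq_zero_of_trace_mul_self (hY : Yᵀ = Y) (h : (Y * Y).trace = 0) : Y = 0 := by
  have h1 := norm_sq_eq_trace Y
  rw [hY, h] at h1
  simpa using h1

/-- The difference N - PNP is tangent, and it is orthogonal to both N and PNP. It is therefore
orthogonal to itself and vanishes. -/
theorem commute_of_orthogonal_tangentSpace {P N : Matrix (Fin n) (Fin n) ℝ} (hP : P ∈ Gr k n)
    (hN : Nᵀ = N) (h : ∀ Y ∈ tangentSpace k n P, metric N Y = 0) : N * P = P * N := by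
  have hPP := mul_self_of_mem_Gr hP
  set Y := N - P * N * P with hYdef
  have hP1 : P * (P * N * P) = N * P := by rw [← mul_assoc, ← mul_assoc, hPP, one_mul]
  have hP2 : P * N * P * P = P * N := by rw [mul_assoc, hPP, mul_one]
  have hY : IsTangent P Y := by
    constructor
    · rw [hYdef, transpose_sub, transpose_mul, transpose_mul, hN, hP.2.1, mul_assoc]
    · rw [hYdef, sub_mul, mul_sub, hP1, hP2]; abel
  have h1 : (N * Y).trace = 0 := by
    have := h Y ((mem_tangentSpace_iff hP).2 hY)
    rwa [metric, hN] at this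
  have h2 : (P * N * P * Y).trace = 0 := by
    have h3 : P * Y * P = -Y := by rw [mul_assoc, hY.2, mul_neg, ← mul_assoc, hPP, one_mul]
    calc (P * N * P * Y).trace = (P * (N * (P * Y))).trace := by simp only [mul_assoc]
      _ = (N * (P * Y * P)).trace := by rw [Matrix.trace_mul_comm, mul_assoc]
      _ = 0 := by rw [h3, mul_neg, trace_neg, h1, neg_zero]
  have h4 : Y = 0 := by
    refine eq_zero_of_trace_mul_self hY.1 ?_
    nth_rw 1 [hYdef]
    rw [sub_mul, trace_sub, h1, h2, sub_zero]
  rw [hYdef, sub_eq_zero] at h4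
  calc N * P = P * N * P * P := by rw [← h4]
    _ = P * N := hP2

/-- Vanishing tangential acceleration means that γ'' commutes with γ. Differentiating γ² = 1 twice
then gives γ''γ + γ'² = 0, so γ'γ is constant, equal to XQ. The geodesic equation becomes the linear
equation γ' = XQγ. -/
theorem IsGeodesic.eq_exp {γ : ℝ → Matrix (Fin n) (Fin n) ℝ} (hγ : IsGeodesic k n γ)
    (h0 : γ 0 = Q) (hX : HasDerivAt γ X 0) : γ 1 = exp (X * Q) * Q := by
  obtain ⟨hs, hG, hacc⟩ := hγ
  have hd : ∀ t, HasDerivAt γ (deriv γ t) t := fun t =>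
    (hs.differentiable (by simp) t).hasDerivAt
  have hs' : ContDiff ℝ ∞ (deriv γ) := (contDiff_infty_iff_deriv.1 hs).2
  have hdd : ∀ t, HasDerivAt (deriv γ) (deriv (deriv γ) t) t := fun t =>
    (hs'.differentiable (by simp) t).hasDerivAt
  have hsymm : ∀ {f : ℝ → Matrix (Fin n) (Fin n) ℝ} {f' : ℝ → Matrix (Fin n) (Fin n) ℝ},
      (∀ t, HasDerivAt f (f' t) t) → (∀ t, (f t)ᵀ = f t) → ∀ t, (f' t)ᵀ = f' t := by
    intro f f' hf hfs t
    have h1 : HasDerivAt (fun t => (f t)ᵀ) (f' t)ᵀ t :=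
      (transposeCLM (Fin n) (Fin n)).hasFDerivAt.comp_hasDerivAt t (hf t)
    simp only [hfs] at h1
    exact h1.unique (hf t)
  have hN : ∀ t, (deriv (deriv γ) t)ᵀ = deriv (deriv γ) t :=
    hsymm hdd (hsymm hd fun t => (hG t).2.1)
  have hcomm : ∀ t, deriv (deriv γ) t * γ t = γ t * deriv (deriv γ) t := fun t =>
    commute_of_orthogonal_tangentSpace (hG t) (hN t) (hacc t)
  have h1 : ∀ t, deriv γ t * γ t + γ t * deriv γ t = 0 := fun t => by
    have h2 := (hd t).mul (hd t)
    rw [show γ * γ = fun _ => 1 from funext fun t => mul_self_of_mem_Gr (hG t)] at h2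
    exact h2.unique (hasDerivAt_const _ _)
  have h2 : ∀ t, deriv (deriv γ) t * γ t + deriv γ t * deriv γ t = 0 := fun t => by
    have h3 := ((hdd t).mul (hd t)).add ((hd t).mul (hdd t))
    rw [show deriv γ * γ + γ * deriv γ = fun _ => 0 from funext h1] at h3
    have h4 := h3.unique (hasDerivAt_const _ _)
    rw [← hcomm] at h4
    have h5 : (2 : ℝ) • (deriv (deriv γ) t * γ t + deriv γ t * deriv γ t) = 0 := by
      rw [two_smul, ← h4]; abel
    exact (smul_eq_zero.1 h5).resolve_left two_ne_zero
  have hconst : ∀ t, deriv γ t * γ t = X * Q := fun t => by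
    have h3 : ∀ t, HasDerivAt (deriv γ * γ) 0 t := fun t => (h2 t) ▸ (hdd t).mul (hd t)
    have h4 := is_const_of_deriv_eq_zero (fun t => (h3 t).differentiableAt)
      (fun t => (h3 t).deriv) t 0
    rw [← h0, ← hX.deriv]
    exact h4
  have hode : ∀ t, deriv γ t = X * Q * γ t := fun t => by
    rw [← hconst t, mul_assoc, mul_self_of_mem_Gr (hG t), mul_one]
  have h3 := PrincipalLog.eq_of_hasDerivAt_zero (f := fun t : ℝ => exp (t • -(X * Q)) * γ t)
    fun t _ => by
      refine ((hasDerivAt_exp_smul_const (-(X * Q)) t).mul (hd t)).congr_deriv ?_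
      rw [hode]
      noncomm_ring
  simp only [one_smul, zero_smul, exp_zero, one_mul, h0] at h3
  calc γ 1 = exp (X * Q) * exp (-(X * Q)) * γ 1 := by rw [exp_mul_exp_neg, one_mul]
    _ = exp (X * Q) * Q := by rw [mul_assoc, h3]

theorem expMap_eq (hQ : Q ∈ Gr k n) (hX : IsTangent Q X) :
    expMap k n Q X = exp (X * Q) * Q := by
  have h := Classical.epsilon_spec (p := fun P => ∃ γ : ℝ → Matrix (Fin n) (Fin n) ℝ,
    IsGeodesic k n γ ∧ γ 0 = Q ∧ HasDerivAt γ X 0 ∧ γ 1 = P)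
    ⟨_, _, hX.isGeodesic hQ, by simp [exp_zero], hasDerivAt_curve_zero hQ, rfl⟩
  obtain ⟨γ, hγ, h0, hd, h1⟩ := h
  exact h1.symm.trans (hγ.eq_exp h0 hd)

end Grassmann

/-! ### Eigenvalues of tangent vectors and the injectivity radius. -/

namespace Grassmann

open Set Filter Topology NormedSpace Matrix PrincipalLog

attribute [local instance] Matrix.frobeniusNormedRing Matrix.frobeniusNormedAlgebra

variable {k n : ℕ} {Q X Y O : Matrix (Fin n) (Fin n) ℝ} {d : Fin n → ℝ}

theorem exists_orthogonal_diagonalization (hX : Xᵀ = X) :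
    ∃ (O : Matrix (Fin n) (Fin n) ℝ) (d : Fin n → ℝ),
      Oᵀ * O = 1 ∧ O * Oᵀ = 1 ∧ X * O = O * diagonal d := by
  have hH : X.IsHermitian := by rwa [IsHermitian, conjTranspose_eq_transpose_of_trivial]
  have h1 := (mem_unitaryGroup_iff'.1 hH.eigenvectorUnitary.2)
  have h2 := (mem_unitaryGroup_iff.1 hH.eigenvectorUnitary.2)
  have h3 := hH.spectral_theorem
  rw [star_eq_conjTranspose, conjTranspose_eq_transpose_of_trivial] at h1 h2
  refine ⟨hH.eigenvectorUnitary, hH.eigenvalues, h1, h2, ?_⟩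
  nth_rw 1 [h3]
  rw [Unitary.conjStarAlgAut_apply, star_eq_conjTranspose, conjTranspose_eq_transpose_of_trivial,
    mul_assoc, h1, mul_one]
  rfl

theorem hasDerivAt_diagonal_cos (d : Fin n → ℝ) (t : ℝ) :
    HasDerivAt (fun t : ℝ => diagonal fun i => Real.cos (t * d i))
      (-(diagonal d * diagonal fun i => Real.sin (t * d i))) t := by
  refine hasDerivAt_of_apply fun i j => ?_
  rw [diagonal_mul_diagonal, diagonal_neg]
  by_cases h : i = j
  · subst h
    simp only [diagonal_apply_eq]
    refine (((hasDerivAt_id t).mul_const (d i)).cos).congr_deriv ?_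
    simp only [id, one_mul]; ring
  · simpa only [diagonal_apply_ne _ h] using hasDerivAt_const t (0 : ℝ)

theorem hasDerivAt_diagonal_sin (d : Fin n → ℝ) (t : ℝ) :
    HasDerivAt (fun t : ℝ => diagonal fun i => Real.sin (t * d i))
      (diagonal d * diagonal fun i => Real.cos (t * d i)) t := by
  refine hasDerivAt_of_apply fun i j => ?_
  rw [diagonal_mul_diagonal]
  by_cases h : i = j
  · subst h
    simp only [diagonal_apply_eq]
    refine (((hasDerivAt_id t).mul_const (d i)).sin).congr_deriv ?_
    simp only [id, one_mul]; ring
  · simpa only [diagonal_apply_ne _ h] using hasDerivAt_const t (0 : ℝ)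

/-- The exponential of the generator on an eigenbasis of the tangent vector. -/
theorem IsTangent.exp_mul_eigenbasis (hQ : Q * Q = 1) (hX : IsTangent Q X)
    (hO : X * O = O * diagonal d) :
    exp (X * Q) * O = O * (diagonal fun i => Real.cos (d i)) -
      Q * O * diagonal fun i => Real.sin (d i) := by
  have h1 : X * Q * O = -(Q * O * diagonal d) := by
    rw [hX.2, neg_mul, mul_assoc, hO, mul_assoc]
  have h2 : X * Q * (Q * O) = O * diagonal d := by
    rw [← mul_assoc, mul_assoc X, hQ, mul_one, hO]
  -- XQ sends O to -QO·diag(d) and QO to O·diag(d), so the trigonometric expression solves the same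
  -- linear equation as exp(tXQ)O.
  have h3 := eq_of_hasDerivAt_zero (f := fun t : ℝ => exp (t • -(X * Q)) *
      (O * (diagonal fun i => Real.cos (t * d i)) -
        Q * O * diagonal fun i => Real.sin (t * d i))) fun t _ => by
    refine ((hasDerivAt_exp_smul_const (-(X * Q)) t).mul
      (((hasDerivAt_diagonal_cos d t).const_mul O).sub
        ((hasDerivAt_diagonal_sin d t).const_mul (Q * O)))).congr_deriv ?_
    rw [mul_assoc, ← mul_add]
    convert mul_zero _
    rw [Pi.sub_apply, mul_sub, neg_mul, neg_mul, ← mul_assoc, h1, ← mul_assoc, h2, mul_neg, neg_mul]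
    simp only [mul_assoc]
    abel
  simp only [one_smul, zero_smul, exp_zero, one_mul, zero_mul, Real.cos_zero, Real.sin_zero,
    diagonal_one, mul_one, diagonal_zero, mul_zero, sub_zero] at h3
  calc exp (X * Q) * O = exp (X * Q) * (exp (-(X * Q)) * (O * (diagonal fun i => Real.cos (d i)) -
      Q * O * diagonal fun i => Real.sin (d i))) := by rw [h3]
    _ = _ := by rw [← mul_assoc, exp_mul_exp_neg, one_mul]

theorem IsTangent.neg (hX : IsTangent Q X) : IsTangent Q (-X) := by
  simpa using hX.smul (-1)

theorem IsTangent.exp_add_exp_neg_mul_eigenbasis (hQ : Q * Q = 1) (hX : IsTangent Q X)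
    (hO : X * O = O * diagonal d) :
    (exp (X * Q) + exp (-(X * Q))) * O = O * diagonal fun i => 2 * Real.cos (d i) := by
  have h1 := hX.exp_mul_eigenbasis hQ hO
  have h2 := hX.neg.exp_mul_eigenbasis (O := O) (d := fun i => -d i) hQ
    (by rw [neg_mul, hO, ← diagonal_neg, mul_neg])
  simp only [Real.cos_neg, Real.sin_neg, neg_mul] at h2
  rw [add_mul, h1, h2, ← diagonal_neg]
  have h3 : (diagonal fun i => 2 * Real.cos (d i)) =
      (diagonal fun i => Real.cos (d i)) + diagonal fun i => Real.cos (d i) := by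
    rw [diagonal_add]; simp only [two_mul]
  rw [h3, mul_add, mul_neg]
  abel

/-- For c = cos φ this is |(1-t) + t e^{iφ}|², which vanishes only when the chord from 1 passes
through 0. -/
theorem segment_cos_pos {t c : ℝ} (ht : t ∈ Icc (0 : ℝ) 1) (hc : -1 < c) :
    0 < (1 - t) ^ 2 + t ^ 2 + (1 - t) * t * (2 * c) := by
  have h : (1 - t) ^ 2 + t ^ 2 + (1 - t) * t * (2 * c)
      = (1 - 2 * t) ^ 2 + 2 * ((1 - t) * t) * (1 + c) := by ring
  rw [h]
  have h1 : 0 ≤ (1 - t) * t := mul_nonneg (by linarith [ht.2]) ht.1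
  rcases eq_or_ne (1 - 2 * t) 0 with h2 | h2
  · have h3 : t = 1 / 2 := by linarith
    subst h3
    nlinarith
  · have : 0 < (1 - 2 * t) ^ 2 := by positivity
    nlinarith [mul_nonneg h1 (by linarith : 0 ≤ 1 + c)]

/-- An eigenbasis of X need not diagonalise the orthogonal matrix M = exp(XQ), but it does
diagonalise M + Mᵀ. Multiplying the segment by its transpose leaves only that combination. -/
theorem IsTangent.segment_mul_transpose (hQ : Q ∈ Gr k n) (hX : IsTangent Q X)
    (hO2 : O * Oᵀ = 1) (hO : X * O = O * diagonal d) (t : ℝ) :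
    (1 + t • (exp (X * Q) - 1)) * (1 + t • (exp (X * Q) - 1))ᵀ = O * (diagonal fun i =>
      (1 - t) ^ 2 + t ^ 2 + (1 - t) * t * (2 * Real.cos (d i))) * Oᵀ := by
  set M := exp (X * Q) with hM
  have hMt : Mᵀ = exp (-(X * Q)) := transpose_exp_of_skew (hX.transpose_generator hQ.2.1)
  have hMM : M * Mᵀ = 1 := by rw [hMt]; exact exp_mul_exp_neg _
  have hsum : M + Mᵀ = O * (diagonal fun i => 2 * Real.cos (d i)) * Oᵀ := by
    rw [← hX.exp_add_exp_neg_mul_eigenbasis (mul_self_of_mem_Gr hQ) hO, ← hMt, mul_assoc, hO2,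
      mul_one]
  have h1 : 1 + t • (M - 1) = (1 - t) • (1 : Matrix (Fin n) (Fin n) ℝ) + t • M := by
    rw [smul_sub, sub_smul, one_smul]; abel
  have h2 : (diagonal fun i => (1 - t) ^ 2 + t ^ 2 + (1 - t) * t * (2 * Real.cos (d i))) =
      ((1 - t) ^ 2 + t ^ 2) • (1 : Matrix (Fin n) (Fin n) ℝ) +
        ((1 - t) * t) • diagonal fun i => 2 * Real.cos (d i) := by
    rw [smul_one_eq_diagonal, ← diagonal_smul, diagonal_add]
    rfl
  rw [h2, h1, mul_add O, add_mul _ _ Oᵀ, mul_smul_comm, mul_smul_comm, smul_mul_assoc _ _ Oᵀ,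
    smul_mul_assoc _ _ Oᵀ, ← hsum, mul_one, hO2, transpose_add, transpose_smul, transpose_smul,
    transpose_one]
  simp only [add_mul, mul_add, smul_mul_assoc, mul_smul_comm, one_mul, mul_one, hMM, smul_smul,
    smul_add, add_smul]
  module

theorem isUnit_conj_diagonal_iff (hO1 : Oᵀ * O = 1) (hO2 : O * Oᵀ = 1) {e : Fin n → ℝ} :
    IsUnit (O * diagonal e * Oᵀ) ↔ ∀ i, e i ≠ 0 := by
  have h1 : IsUnit O := IsUnit.of_mul_eq_one _ hO2
  have h2 : IsUnit Oᵀ := IsUnit.of_mul_eq_one _ hO1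
  rw [h2.mul_right_iff, h1.mul_left_iff, Matrix.isUnit_diagonal, Pi.isUnit_iff]
  simp only [isUnit_iff_ne_zero]

theorem IsTangent.exp_mem_domain (hQ : Q ∈ Gr k n) (hX : IsTangent Q X)
    (hO1 : Oᵀ * O = 1) (hO2 : O * Oᵀ = 1)
    (hO : X * O = O * diagonal d) (hd : ∀ i, |d i| < Real.pi) :
    exp (X * Q) ∈ domain (Matrix (Fin n) (Fin n) ℝ) := by
  intro t ht
  have hu : IsUnit ((1 + t • (exp (X * Q) - 1)) * (1 + t • (exp (X * Q) - 1))ᵀ) := by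
    rw [hX.segment_mul_transpose hQ hO2 hO, isUnit_conj_diagonal_iff hO1 hO2]
    intro i
    refine (segment_cos_pos ht ?_).ne'
    rw [← Real.cos_pi, ← Real.cos_abs (d i)]
    exact Real.cos_lt_cos_of_nonneg_of_le_pi (abs_nonneg _) le_rfl (hd i)
  rw [Matrix.isUnit_iff_isUnit_det, det_mul] at hu
  rw [Matrix.isUnit_iff_isUnit_det]
  exact isUnit_of_mul_isUnit_left hu

theorem IsTangent.abs_eigenvalue_ne_pi (hQ : Q ∈ Gr k n) (hX : IsTangent Q X)
    (hO1 : Oᵀ * O = 1) (hO2 : O * Oᵀ = 1) (hO : X * O = O * diagonal d)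
    (hM : exp (X * Q) ∈ domain (Matrix (Fin n) (Fin n) ℝ)) (i : Fin n) : |d i| ≠ Real.pi := by
  intro hi
  -- For an eigenvalue ±π the segment becomes singular at its midpoint.
  have hu := hM 2⁻¹ ⟨by norm_num, by norm_num⟩
  have hu' : IsUnit (1 + (2⁻¹ : ℝ) • (exp (X * Q) - 1))ᵀ := (Matrix.isUnit_transpose _).2 hu
  have h := hu.mul hu'
  rw [hX.segment_mul_transpose hQ hO2 hO, isUnit_conj_diagonal_iff hO1 hO2] at h
  refine h i ?_
  rw [← Real.cos_abs, hi, Real.cos_pi]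
  norm_num

theorem IsTangent.plog_exp (hQ : Q ∈ Gr k n) (hX : IsTangent Q X)
    (hO1 : Oᵀ * O = 1) (hO2 : O * Oᵀ = 1)
    (hO : X * O = O * diagonal d) (hd : ∀ i, |d i| < Real.pi) :
    plog (exp (X * Q)) = X * Q := by
  refine PrincipalLog.plog_exp fun s hs => ?_
  have h := (hX.smul s).exp_mem_domain (d := s • d) hQ hO1 hO2
    (by rw [smul_mul_assoc, hO, diagonal_smul, mul_smul_comm]) fun i => ?_
  · rwa [smul_mul_assoc] at h
  · rw [Pi.smul_apply, smul_eq_mul, abs_mul, abs_of_nonneg hs.1]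
    exact (mul_le_of_le_one_left (abs_nonneg _) hs.2).trans_lt (hd i)

theorem sq_dotProduct_add_sq_dotProduct_le {v w : Fin n → ℝ} (hv : v ⬝ᵥ v = 1) (hw : w ⬝ᵥ w = 1)
    (hvw : v ⬝ᵥ w = 0) (x : Fin n → ℝ) : (x ⬝ᵥ v) ^ 2 + (x ⬝ᵥ w) ^ 2 ≤ x ⬝ᵥ x := by
  have hwv : w ⬝ᵥ v = 0 := by rw [dotProduct_comm, hvw]
  have h : 0 ≤ (x - (x ⬝ᵥ v) • v - (x ⬝ᵥ w) • w) ⬝ᵥ (x - (x ⬝ᵥ v) • v - (x ⬝ᵥ w) • w) :=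
    Finset.sum_nonneg fun i _ => mul_self_nonneg _
  simp only [sub_dotProduct, dotProduct_sub, smul_dotProduct, dotProduct_smul, smul_eq_mul, hv, hw,
    hvw, hwv, dotProduct_comm v x, dotProduct_comm w x] at h
  nlinarith

/-- Bessel's inequality for each row of X, summed over the rows. -/
theorem mulVec_dotProduct_self_add_le {v w : Fin n → ℝ} (hv : v ⬝ᵥ v = 1) (hw : w ⬝ᵥ w = 1)
    (hvw : v ⬝ᵥ w = 0) (X : Matrix (Fin n) (Fin n) ℝ) :
    (X *ᵥ v) ⬝ᵥ (X *ᵥ v) + (X *ᵥ w) ⬝ᵥ (X *ᵥ w) ≤ ‖X‖ ^ 2 := by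
  rw [norm_sq_eq_trace, Matrix.trace_mul_comm, Matrix.trace]
  simp only [dotProduct, ← Finset.sum_add_distrib]
  refine Finset.sum_le_sum fun i _ => ?_
  have := sq_dotProduct_add_sq_dotProduct_le hv hw hvw (X i)
  rw [sq, sq] at this
  exact this

/-- Qv is a unit eigenvector for -c and, when c ≠ 0, is orthogonal to v. Each of the two directions
contributes c² to ‖X‖²; this is the source of the √2 in the radius. -/
theorem IsTangent.two_mul_sq_eigenvalue_le (hQ : Q ∈ Gr k n) (hX : IsTangent Q X)
    {v : Fin n → ℝ} {c : ℝ} (hv : v ⬝ᵥ v = 1) (hXv : X *ᵥ v = c • v) : 2 * c ^ 2 ≤ ‖X‖ ^ 2 := by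
  rcases eq_or_ne c 0 with rfl | hc
  · simp only [ne_eq, OfNat.ofNat_ne_zero, not_false_eq_true, zero_pow, mul_zero]; positivity
  have hsymm : ∀ {S : Matrix (Fin n) (Fin n) ℝ}, Sᵀ = S → ∀ a b : Fin n → ℝ,
      (S *ᵥ a) ⬝ᵥ b = a ⬝ᵥ (S *ᵥ b) := fun hS a b => by
    rw [dotProduct_mulVec, ← mulVec_transpose, hS]
  have hQv : X *ᵥ (Q *ᵥ v) = -c • (Q *ᵥ v) := by
    rw [mulVec_mulVec, hX.2, neg_mulVec, ← mulVec_mulVec, hXv, mulVec_smul, neg_smul]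
  have hww : (Q *ᵥ v) ⬝ᵥ (Q *ᵥ v) = 1 := by
    rw [hsymm hQ.2.1, mulVec_mulVec, mul_self_of_mem_Gr hQ, one_mulVec, hv]
  have hvw : v ⬝ᵥ (Q *ᵥ v) = 0 := by
    have h1 := hsymm hX.1 v (Q *ᵥ v)
    rw [hXv, hQv, smul_dotProduct, dotProduct_smul, smul_eq_mul, smul_eq_mul] at h1
    have h2 : c * (v ⬝ᵥ (Q *ᵥ v)) = 0 := by linarith
    exact (mul_eq_zero.1 h2).resolve_left hc
  have h := mulVec_dotProduct_self_add_le hv hww hvw X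
  rw [hXv, hQv] at h
  simp only [smul_dotProduct, dotProduct_smul, hv, hww, smul_eq_mul] at h
  linarith

theorem IsTangent.abs_eigenvalue_lt_pi (hQ : Q ∈ Gr k n) (hX : IsTangent Q X)
    (hnorm : ‖X‖ < Real.sqrt 2 * Real.pi) (hO1 : Oᵀ * O = 1) (hO : X * O = O * diagonal d)
    (i : Fin n) : |d i| < Real.pi := by
  have hv : (O *ᵥ Pi.single i 1) ⬝ᵥ (O *ᵥ Pi.single i 1) = 1 := by
    rw [dotProduct_mulVec, ← mulVec_transpose, mulVec_mulVec, hO1, one_mulVec]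
    simp
  have hXv : X *ᵥ (O *ᵥ Pi.single i 1) = d i • (O *ᵥ Pi.single i 1) := by
    rw [mulVec_mulVec, hO, ← mulVec_mulVec, ← mulVec_smul]
    congr 1
    ext j
    by_cases h : j = i
    · subst h; simp [mulVec_diagonal]
    · simp [mulVec_diagonal, h]
  have h1 := hX.two_mul_sq_eigenvalue_le hQ hv hXv
  have h2 : ‖X‖ ^ 2 < (Real.sqrt 2 * Real.pi) ^ 2 := by gcongr
  rw [mul_pow, Real.sq_sqrt zero_le_two] at h2
  exact abs_lt_of_sq_lt_sq (by linarith) Real.pi_pos.le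

theorem IsTangent.exp_mem_domain_of_norm_lt (hQ : Q ∈ Gr k n) (hX : IsTangent Q X)
    (hnorm : ‖X‖ < Real.sqrt 2 * Real.pi) :
    exp (X * Q) ∈ domain (Matrix (Fin n) (Fin n) ℝ) := by
  obtain ⟨O, d, h1, h2, h3⟩ := exists_orthogonal_diagonalization hX.1
  exact hX.exp_mem_domain hQ h1 h2 h3 (hX.abs_eigenvalue_lt_pi hQ hnorm h1 h3)

theorem IsTangent.plog_exp_of_norm_lt (hQ : Q ∈ Gr k n) (hX : IsTangent Q X)
    (hnorm : ‖X‖ < Real.sqrt 2 * Real.pi) : plog (exp (X * Q)) = X * Q := by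
  obtain ⟨O, d, h1, h2, h3⟩ := exists_orthogonal_diagonalization hX.1
  exact hX.plog_exp hQ h1 h2 h3 (hX.abs_eigenvalue_lt_pi hQ hnorm h1 h3)

theorem mem_tangentBall_sqrt_two_mul_pi (hQ : Q ∈ Gr k n) :
    X ∈ tangentBall k n Q (ENNReal.ofReal (Real.sqrt 2 * Real.pi)) ↔
      IsTangent Q X ∧ ‖X‖ < Real.sqrt 2 * Real.pi := by
  rw [tangentBall, mem_ofPred_eq, mem_tangentSpace_iff hQ, rnorm_eq_norm,
    ENNReal.ofReal_lt_ofReal_iff (by positivity)]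

/-- The inverse is P ↦ plog(PQ)Q, which is smooth on an open set of the ambient matrix space. -/
theorem isDiffeoOn_expMap (hQ : Q ∈ Gr k n) : IsDiffeoOn (expMap k n Q)
    (tangentBall k n Q (ENNReal.ofReal (Real.sqrt 2 * Real.pi))) := by
  have hQQ := mul_self_of_mem_Gr hQ
  have hexp : ∀ X ∈ tangentBall k n Q (ENNReal.ofReal (Real.sqrt 2 * Real.pi)),
      expMap k n Q X = exp (X * Q) * Q := fun X hX =>
    expMap_eq hQ ((mem_tangentBall_sqrt_two_mul_pi hQ).1 hX).1
  refine ⟨fun X _ => ⟨univ, isOpen_univ, mem_univ X, fun X => exp (X * Q) * Q, ?_,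
    fun Y hY => (hexp Y hY.1).symm⟩, fun P => plog (P * Q) * Q, fun X hX => ?_, ?_⟩
  · exact ((contDiff_normedSpace_exp.comp (contDiff_id.mul contDiff_const)).mul
      contDiff_const).contDiffOn
  · obtain ⟨hT, hn⟩ := (mem_tangentBall_sqrt_two_mul_pi hQ).1 hX
    simp only [hexp X hX]
    rw [mul_assoc (exp (X * Q)), hQQ, mul_one, hT.plog_exp_of_norm_lt hQ hn, mul_assoc, hQQ, mul_one]
  · rintro _ ⟨X, hX, rfl⟩
    obtain ⟨hT, hn⟩ := (mem_tangentBall_sqrt_two_mul_pi hQ).1 hX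
    refine ⟨(fun P => P * Q) ⁻¹' domain (Matrix (Fin n) (Fin n) ℝ),
      isOpen_domain.preimage (continuous_id.mul continuous_const), ?_, _, ?_, fun _ _ => rfl⟩
    · rw [mem_preimage, hexp X hX, mul_assoc, hQQ, mul_one]
      exact hT.exp_mem_domain_of_norm_lt hQ hn
    · exact (contDiffOn_plog.comp (contDiff_id.mul contDiff_const).contDiffOn
        fun _ h => h).mul contDiffOn_const

theorem sqrt_two_mul_pi_le_injRadius (hQ : Q ∈ Gr k n) :
    ENNReal.ofReal (Real.sqrt 2 * Real.pi) ≤ injRadius k n Q :=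
  le_sSup (isDiffeoOn_expMap hQ)

/-- The balls are open, so any two vectors below the supremum lie in a common ball of an admissible
radius. -/
theorem injOn_expMap_injRadius (k n : ℕ) (Q : Matrix (Fin n) (Fin n) ℝ) :
    InjOn (expMap k n Q) (tangentBall k n Q (injRadius k n Q)) := by
  intro X hX Y hY h
  obtain ⟨r, hr, hr'⟩ := lt_sSup_iff.1 (max_lt hX.2 hY.2)
  obtain ⟨-, g, hg, -⟩ := hr
  exact hg.injOn ⟨hX.1, (le_max_left _ _).trans_lt hr'⟩ ⟨hY.1, (le_max_right _ _).trans_lt hr'⟩ h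

theorem log_of_norm_lt (hQ : Q ∈ Gr k n) (hX : IsTangent Q X)
    (hnorm : ‖X‖ < Real.sqrt 2 * Real.pi) :
    exp (X * Q) * Q ∈ logDomain k n Q ∧ logMap k n Q (exp (X * Q) * Q) = X := by
  have hmem : X ∈ tangentBall k n Q (injRadius k n Q) :=
    have h := (mem_tangentBall_sqrt_two_mul_pi hQ).2 ⟨hX, hnorm⟩
    ⟨h.1, h.2.trans_le (sqrt_two_mul_pi_le_injRadius hQ)⟩
  rw [← expMap_eq hQ hX]
  exact ⟨mem_image_of_mem _ hmem, (injOn_expMap_injRadius k n Q).leftInvOn_invFunOn hmem⟩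

end Grassmann

/-! ### The Gauss lemma, and curves shorter than √2π. -/

namespace Grassmann

open Set Filter Topology NormedSpace Matrix PrincipalLog

attribute [local instance] Matrix.frobeniusNormedRing Matrix.frobeniusNormedAlgebra

variable {k n : ℕ} {Q P X : Matrix (Fin n) (Fin n) ℝ}

theorem norm_orthogonal_mul {O : Matrix (Fin n) (Fin n) ℝ} (hO : Oᵀ * O = 1)
    (X : Matrix (Fin n) (Fin n) ℝ) : ‖O * X‖ = ‖X‖ := by
  rw [← sq_eq_sq₀ (norm_nonneg _) (norm_nonneg _), norm_sq_eq_trace, norm_sq_eq_trace,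
    transpose_mul, mul_assoc, ← mul_assoc Oᵀ, hO, one_mul]

theorem norm_mul_orthogonal {O : Matrix (Fin n) (Fin n) ℝ} (hO : O * Oᵀ = 1)
    (X : Matrix (Fin n) (Fin n) ℝ) : ‖X * O‖ = ‖X‖ := by
  rw [← frobenius_norm_transpose, transpose_mul, norm_orthogonal_mul, frobenius_norm_transpose]
  rwa [transpose_transpose]

theorem ringInverse_mul_of_mem_Gr (hQ : Q ∈ Gr k n) (hP : P ∈ Gr k n) :
    Ring.inverse (P * Q) = Q * P := by
  have hQQ := mul_self_of_mem_Gr hQ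
  have hPP := mul_self_of_mem_Gr hP
  have h1 : P * Q * (Q * P) = 1 := by
    rw [mul_assoc, ← mul_assoc Q, hQQ, one_mul, hPP]
  have h2 : Q * P * (P * Q) = 1 := by
    rw [mul_assoc, ← mul_assoc P, hPP, one_mul, hQQ]
  exact Ring.inverse_unit (⟨_, _, h1, h2⟩ : (Matrix (Fin n) (Fin n) ℝ)ˣ)

theorem transpose_plog (hQ : Q ∈ Gr k n) (hP : P ∈ Gr k n)
    (hM : P * Q ∈ domain (Matrix (Fin n) (Fin n) ℝ)) : (plog (P * Q))ᵀ = -plog (P * Q) := by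
  rw [← plog_inverse hM, ringInverse_mul_of_mem_Gr hQ hP]
  -- Transposition reverses products, but on commuting pairs it is multiplicative, which is all that
  -- `map_plog` asks.
  have h : (plog (P * Q))ᵀ = plog (P * Q)ᵀ :=
    map_plog hM (transposeCLM (Fin n) (Fin n)) transpose_one fun a b hab => by
      rw [hab.eq]; exact transpose_mul b a
  rwa [transpose_mul, hQ.2.1, hP.2.1] at h

theorem conj_plog (hQ : Q ∈ Gr k n) (hP : P ∈ Gr k n)
    (hM : P * Q ∈ domain (Matrix (Fin n) (Fin n) ℝ)) : Q * plog (P * Q) * Q = -plog (P * Q) := by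
  have hQQ := mul_self_of_mem_Gr hQ
  rw [← plog_inverse hM, ringInverse_mul_of_mem_Gr hQ hP]
  have h := map_plog hM (ContinuousLinearMap.mulLeftRight ℝ _ Q Q) (by simp [hQQ]) fun a b _ => by
    simp only [ContinuousLinearMap.mulLeftRight_apply]
    calc Q * (a * b) * Q = Q * a * (1 * (b * Q)) := by simp only [mul_assoc, one_mul]
      _ = Q * a * Q * (Q * b * Q) := by rw [← hQQ]; simp only [mul_assoc]
  simp only [ContinuousLinearMap.mulLeftRight_apply] at h
  rw [h, mul_assoc, mul_assoc, hQQ, mul_one]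

/-- Transposing PQ and conjugating it by Q both give QP = (PQ)⁻¹, so both operations negate the
logarithm. -/
theorem isTangent_plog_mul (hQ : Q ∈ Gr k n) (hP : P ∈ Gr k n)
    (hM : P * Q ∈ domain (Matrix (Fin n) (Fin n) ℝ)) : IsTangent Q (plog (P * Q) * Q) := by
  have hQQ := mul_self_of_mem_Gr hQ
  have h1 := conj_plog hQ hP hM
  constructor
  · rw [transpose_mul, transpose_plog hQ hP hM, hQ.2.1, ← h1, mul_assoc Q, ← mul_assoc, ← mul_assoc,
      hQQ, one_mul]
  · rw [mul_assoc, hQQ, mul_one, ← mul_assoc, h1, neg_neg]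

theorem exp_plog_mul (hQ : Q ∈ Gr k n) (hM : P * Q ∈ domain (Matrix (Fin n) (Fin n) ℝ)) :
    exp (plog (P * Q) * Q * Q) * Q = P := by
  have hQQ := mul_self_of_mem_Gr hQ
  have h := exp_plog hM
  rw [mul_assoc (plog (P * Q)), hQQ, mul_one]
  calc _ = P * Q * Q := congrArg (· * Q) h
    _ = P := by rw [mul_assoc, hQQ, mul_one]

theorem norm_sq_plog (hQ : Q ∈ Gr k n) (hP : P ∈ Gr k n)
    (hM : P * Q ∈ domain (Matrix (Fin n) (Fin n) ℝ)) :
    ‖plog (P * Q)‖ ^ 2 = -(plog (P * Q) * plog (P * Q)).trace := by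
  rw [norm_sq_eq_trace, transpose_plog hQ hP hM, neg_mul, trace_neg]

/-- The Gauss lemma: the derivative of the squared norm of the logarithm. -/
theorem exists_hasDerivAt_trace_plog_sq (hQ : Q ∈ Gr k n)
    {γ : ℝ → Matrix (Fin n) (Fin n) ℝ} {γ' : Matrix (Fin n) (Fin n) ℝ} {t : ℝ}
    (hP : γ t ∈ Gr k n) (hγ : HasDerivAt γ γ' t)
    (hM : γ t * Q ∈ domain (Matrix (Fin n) (Fin n) ℝ)) :
    ∃ c, c ≤ 2 * (‖plog (γ t * Q)‖ * ‖γ'‖) ∧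
      HasDerivAt (fun s => -(plog (γ s * Q) * plog (γ s * Q)).trace) c t := by
  set D := (∫ s in (0 : ℝ)..1, ContinuousLinearMap.mulLeftRight ℝ (Matrix (Fin n) (Fin n) ℝ)
    (PrincipalLog.resolvent (γ t * Q) s) (PrincipalLog.resolvent (γ t * Q) s)) (γ' * Q) with hD
  have h1 : HasDerivAt (fun s => plog (γ s * Q)) D t :=
    hasDerivAt_plog_comp hM (hγ.mul_const Q)
  have h2 : HasDerivAt (fun s => -(plog (γ s * Q) * plog (γ s * Q)).trace)
      (-(D * plog (γ t * Q) + plog (γ t * Q) * D).trace) t :=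
    ((traceCLM (Fin n)).hasFDerivAt.comp_hasDerivAt t (h1.mul h1)).neg
  refine ⟨_, ?_, h2⟩
  have h3 : (plog (γ t * Q) * D).trace =
      (plog (γ t * Q) * Ring.inverse (γ t * Q) * (γ' * Q)).trace :=
    tracial_mul_plog_deriv hM (traceCLM (Fin n)) Matrix.trace_mul_comm (γ' * Q)
  rw [ringInverse_mul_of_mem_Gr hQ hP] at h3
  have hQ' : Q * Qᵀ = 1 := by rw [hQ.2.1, mul_self_of_mem_Gr hQ]
  have h4 : ‖Q * γ t * (γ' * Q)‖ = ‖γ'‖ := by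
    rw [← mul_assoc, norm_mul_orthogonal hQ', mul_assoc, norm_orthogonal_mul hQ.1,
      norm_orthogonal_mul hP.1]
  rw [trace_add, Matrix.trace_mul_comm D, h3]
  -- Cauchy–Schwarz. Multiplication by Q and γ(t) is orthogonal, so the second factor has norm ‖γ'‖.
  have h5 := trace_transpose_mul_le (plog (γ t * Q)) (Q * γ t * (γ' * Q))
  rw [h4, transpose_plog hQ hP hM, neg_mul, trace_neg, ← mul_assoc] at h5
  linarith

theorem norm_plog_le_length (hQ : Q ∈ Gr k n) {γ : ℝ → Matrix (Fin n) (Fin n) ℝ}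
    (hγ : ContDiffOn ℝ 1 γ (Icc 0 1)) (hG : ∀ t ∈ Icc (0 : ℝ) 1, γ t ∈ Gr k n) (h0 : γ 0 = Q)
    {T : ℝ} (hT : T ∈ Icc (0 : ℝ) 1)
    (hM : ∀ t ∈ Icc (0 : ℝ) T, γ t * Q ∈ domain (Matrix (Fin n) (Fin n) ℝ)) :
    ‖plog (γ T * Q)‖ ≤ ∫ t in (0 : ℝ)..T, ‖derivWithin γ (Icc 0 1) t‖ := by
  have hsub : Icc 0 T ⊆ Icc (0 : ℝ) 1 := Icc_subset_Icc_right hT.2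
  have hsub' : Ioo 0 T ⊆ Ioo (0 : ℝ) 1 := Ioo_subset_Ioo_right hT.2
  have hc : ContinuousOn (fun t => ‖derivWithin γ (Icc 0 1) t‖) (Icc 0 1) :=
    (hγ.continuousOn_derivWithin (uniqueDiffOn_Icc zero_lt_one) le_rfl).norm
  have hd : ∀ t ∈ Ioo (0 : ℝ) 1, HasDerivAt γ (derivWithin γ (Icc 0 1) t) t := fun t ht =>
    (hγ.differentiableOn one_ne_zero t (Ioo_subset_Icc_self ht)).hasDerivWithinAt.hasDerivAt
      (Icc_mem_nhds ht.1 ht.2)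
  set s : ℝ → ℝ := fun x => ∫ t in (0 : ℝ)..x, ‖derivWithin γ (Icc 0 1) t‖ with hs
  have hsd : ∀ t ∈ Ioo (0 : ℝ) 1, HasDerivAt s ‖derivWithin γ (Icc 0 1) t‖ t := fun t ht =>
    intervalIntegral.integral_hasDerivAt_right
      ((hc.mono (by rw [uIcc_of_le ht.1.le]; exact Icc_subset_Icc_right ht.2.le)).intervalIntegrable)
      ((hc.mono Ioo_subset_Icc_self).stronglyMeasurableAtFilter isOpen_Ioo t ht)
      (hc.continuousAt (Icc_mem_nhds ht.1 ht.2))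
  have hsc : ContinuousOn s (Icc 0 T) := by
    have := intervalIntegral.continuousOn_primitive_interval (a := 0) (b := T)
      (f := fun t => ‖derivWithin γ (Icc 0 1) t‖) (μ := MeasureTheory.volume) (by
        rw [uIcc_of_le hT.1]
        exact (hc.mono hsub).integrableOn_Icc)
    rwa [uIcc_of_le hT.1] at this
  have hΩc : ContinuousOn (fun t => plog (γ t * Q)) (Icc 0 T) :=
    contDiffOn_plog.continuousOn.comp ((hγ.continuousOn.mono hsub).mul continuousOn_const) hM
  set h : ℝ → ℝ := fun t => -(plog (γ t * Q) * plog (γ t * Q)).trace with hh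
  have hhn : ∀ t ∈ Icc (0 : ℝ) T, ‖plog (γ t * Q)‖ ^ 2 = h t := fun t ht =>
    norm_sq_plog hQ (hG t (hsub ht)) (hM t ht)
  have hhc : ContinuousOn h (Icc 0 T) :=
    ((traceCLM (Fin n)).continuous.comp_continuousOn (hΩc.mul hΩc)).neg
  -- The norm is not differentiable at 0, where the curve starts. It is replaced by √(ε² + ‖·‖²),
  -- whose derivative along the curve is still at most ‖γ'‖.
  refine le_of_forall_pos_le_add fun ε hε => ?_
  have hpos : ∀ t ∈ Icc (0 : ℝ) T, 0 < ε ^ 2 + h t := fun t ht => by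
    rw [← hhn t ht]; positivity
  have hderiv : ∀ t ∈ Ioo (0 : ℝ) T, ∃ c ≤ 0,
      HasDerivAt (fun t => Real.sqrt (ε ^ 2 + h t) - s t) c t := by
    intro t ht
    have ht' := Ioo_subset_Icc_self ht
    obtain ⟨c, hcle, hcd⟩ := exists_hasDerivAt_trace_plog_sq hQ (hG t (hsub ht')) (hd t (hsub' ht))
      (hM t ht')
    refine ⟨_, ?_, ((hcd.const_add (ε ^ 2)).sqrt (hpos t ht').ne').sub (hsd t (hsub' ht))⟩
    have hr : 0 < Real.sqrt (ε ^ 2 + h t) := Real.sqrt_pos.2 (hpos t ht')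
    have hle : ‖plog (γ t * Q)‖ ≤ Real.sqrt (ε ^ 2 + h t) := by
      refine Real.le_sqrt_of_sq_le ?_
      rw [hhn t ht']
      exact le_add_of_nonneg_left (sq_nonneg ε)
    rw [sub_nonpos, div_le_iff₀ (by positivity)]
    nlinarith [mul_le_mul_of_nonneg_right hle (norm_nonneg (derivWithin γ (Icc 0 1) t))]
  have hanti : AntitoneOn (fun t => Real.sqrt (ε ^ 2 + h t) - s t) (Icc 0 T) := by
    refine antitoneOn_of_deriv_nonpos (convex_Icc 0 T)
      ((continuousOn_const.add hhc).sqrt.sub hsc) ?_ ?_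
    · intro t ht
      rw [interior_Icc] at ht
      obtain ⟨c, -, hc⟩ := hderiv t ht
      exact hc.differentiableAt.differentiableWithinAt
    · intro t ht
      rw [interior_Icc] at ht
      obtain ⟨c, hc0, hc⟩ := hderiv t ht
      rwa [hc.deriv]
  have h1 := hanti (left_mem_Icc.2 hT.1) (right_mem_Icc.2 hT.1) hT.1
  have h2 : h 0 = 0 := by
    simp only [hh, h0, mul_self_of_mem_Gr hQ, plog_one]
    simp
  have h3 : s 0 = 0 := by simp [hs]
  simp only [h2, h3, add_zero, sub_zero, Real.sqrt_sq hε.le] at h1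
  have h4 : ‖plog (γ T * Q)‖ ≤ Real.sqrt (ε ^ 2 + h T) := by
    refine Real.le_sqrt_of_sq_le ?_
    rw [hhn T (right_mem_Icc.2 hT.1)]
    exact le_add_of_nonneg_left (sq_nonneg ε)
  linarith

theorem isCompact_exp_image (Q : Matrix (Fin n) (Fin n) ℝ) (r : ℝ) :
    IsCompact ((fun X => exp (X * Q) * Q) '' {X | IsTangent Q X ∧ ‖X‖ ≤ r}) := by
  have hcont : Continuous fun X : Matrix (Fin n) (Fin n) ℝ => exp (X * Q) * Q :=
    ((contDiff_normedSpace_exp.continuous).comp (continuous_id.mul continuous_const)).mul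
      continuous_const
  refine IsCompact.image ?_ hcont
  have h1 : IsClosed {X : Matrix (Fin n) (Fin n) ℝ | IsTangent Q X} :=
    (isClosed_eq (transposeCLM (Fin n) (Fin n)).continuous continuous_id).inter
      (isClosed_eq (continuous_id.mul continuous_const) (continuous_const.mul continuous_id).neg)
  have h2 : {X : Matrix (Fin n) (Fin n) ℝ | IsTangent Q X ∧ ‖X‖ ≤ r} =
      {X | IsTangent Q X} ∩ Metric.closedBall 0 r := by
    ext X; simp
  rw [h2]
  exact (isCompact_closedBall 0 r).inter_left h1

theorem mem_exp_image_of_domain (hQ : Q ∈ Gr k n) {γ : ℝ → Matrix (Fin n) (Fin n) ℝ}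
    (hγ : ContDiffOn ℝ 1 γ (Icc 0 1)) (hG : ∀ t ∈ Icc (0 : ℝ) 1, γ t ∈ Gr k n) (h0 : γ 0 = Q)
    {T : ℝ} (hT : T ∈ Icc (0 : ℝ) 1)
    (hM : ∀ t ∈ Icc (0 : ℝ) T, γ t * Q ∈ domain (Matrix (Fin n) (Fin n) ℝ)) :
    γ T ∈ (fun X => exp (X * Q) * Q) '' {X | IsTangent Q X ∧
      ‖X‖ ≤ ∫ t in (0 : ℝ)..1, ‖derivWithin γ (Icc 0 1) t‖} := by
  have hMT := hM T (right_mem_Icc.2 hT.1)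
  refine ⟨plog (γ T * Q) * Q, ⟨isTangent_plog_mul hQ (hG T hT) hMT, ?_⟩, exp_plog_mul hQ hMT⟩
  rw [norm_mul_orthogonal (by rw [hQ.2.1, mul_self_of_mem_Gr hQ])]
  refine (norm_plog_le_length hQ hγ hG h0 hT hM).trans ?_
  have hc : ContinuousOn (fun t => ‖derivWithin γ (Icc 0 1) t‖) (Icc 0 1) :=
    (hγ.continuousOn_derivWithin (uniqueDiffOn_Icc zero_lt_one) le_rfl).norm
  exact intervalIntegral.integral_mono_interval le_rfl hT.1 hT.2
    (Eventually.of_forall fun t => norm_nonneg _) (intervalIntegrable_of_continuousOn hc)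

/-- A curve shorter than `√2 π` ends at the exponential of a tangent vector that is no longer. -/
theorem exists_isTangent_of_length_lt (hQ : Q ∈ Gr k n) {γ : ℝ → Matrix (Fin n) (Fin n) ℝ}
    (hγ : ContDiffOn ℝ 1 γ (Icc 0 1)) (hG : ∀ t ∈ Icc (0 : ℝ) 1, γ t ∈ Gr k n) (h0 : γ 0 = Q)
    (hlen : ∫ t in (0 : ℝ)..1, ‖derivWithin γ (Icc 0 1) t‖ < Real.sqrt 2 * Real.pi) :
    ∃ X, IsTangent Q X ∧ ‖X‖ < Real.sqrt 2 * Real.pi ∧ exp (X * Q) * Q = γ 1 := by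
  have hQQ := mul_self_of_mem_Gr hQ
  have hall : ∀ t ∈ Icc (0 : ℝ) 1, γ t * Q ∈ domain (Matrix (Fin n) (Fin n) ℝ) := by
    by_contra! hne
    set J := Icc (0 : ℝ) 1 ∩ (fun t => γ t * Q) ⁻¹' (domain (Matrix (Fin n) (Fin n) ℝ))ᶜ with hJ
    have hJc : IsClosed J := (hγ.continuousOn.mul continuousOn_const).preimage_isClosed_of_isClosed
      isClosed_Icc isOpen_domain.isClosed_compl
    have hJne : J.Nonempty := hne
    have hJb : BddBelow J := ⟨0, fun t ht => ht.1.1⟩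
    -- The infimum is attained because `domain` is open, so T is the first time at which the curve
    -- leaves it.
    have hTJ := hJc.csInf_mem hJne hJb
    set T := sInf J with hTdef
    have hT0 : T ≠ 0 := by
      intro h
      apply hTJ.2
      simp only [h, h0, hQQ]
      exact one_mem_domain
    have hTpos : 0 < T := lt_of_le_of_ne hTJ.1.1 hT0.symm
    have hlt : ∀ t ∈ Ico 0 T, γ t * Q ∈ domain (Matrix (Fin n) (Fin n) ℝ) := fun t ht => by
      by_contra hcon
      exact (csInf_le hJb ⟨⟨ht.1, ht.2.le.trans hTJ.1.2⟩, hcon⟩).not_gt ht.2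
    have hmem : γ T ∈ (fun X => exp (X * Q) * Q) '' {X | IsTangent Q X ∧
        ‖X‖ ≤ ∫ t in (0 : ℝ)..1, ‖derivWithin γ (Icc 0 1) t‖} := by
      -- Before T the curve lies in the compact image of a closed ball of radius below √2π. So does
      -- its limit γ(T), and that image corresponds to points of `domain`, a contradiction.
      refine (isCompact_exp_image Q _).isClosed.closure_subset ?_
      have hcl : T ∈ closure (Ico 0 T) := by
        rw [closure_Ico hTpos.ne]; exact right_mem_Icc.2 hTpos.le
      refine ((hγ.continuousOn T hTJ.1).mono fun t ht =>
        ⟨ht.1, ht.2.le.trans hTJ.1.2⟩).mem_closure hcl fun t ht => ?_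
      exact mem_exp_image_of_domain hQ hγ hG h0 ⟨ht.1, ht.2.le.trans hTJ.1.2⟩ fun s hs =>
        hlt s ⟨hs.1, hs.2.trans_lt ht.2⟩
    obtain ⟨X, ⟨hX, hXn⟩, hXT⟩ := hmem
    apply hTJ.2
    simp only at hXT
    simp only [← hXT]
    rw [mul_assoc, hQQ, mul_one]
    exact hX.exp_mem_domain_of_norm_lt hQ (hXn.trans_lt hlen)
  obtain ⟨X, ⟨hX, hXn⟩, hX1⟩ := mem_exp_image_of_domain hQ hγ hG h0 (right_mem_Icc.2 zero_le_one) hall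
  exact ⟨X, hX, hXn.trans_lt hlen, hX1⟩

theorem exists_isTangent_of_geodesicDist_lt {Q₀ Q₁ : Matrix (Fin n) (Fin n) ℝ}
    (hQ₀ : Q₀ ∈ Gr k n)
    (hd : geodesicDist k n Q₀ Q₁ < ENNReal.ofReal (Real.sqrt 2 * Real.pi)) :
    ∃ X, IsTangent Q₀ X ∧ ‖X‖ < Real.sqrt 2 * Real.pi ∧ exp (X * Q₀) * Q₀ = Q₁ := by
  simp only [geodesicDist, iInf_lt_iff, rnorm_eq_norm] at hd
  obtain ⟨γ, hγ, hG, h0, h1, hlt⟩ := hd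
  rw [ENNReal.ofReal_lt_ofReal_iff (by positivity)] at hlt
  rw [← h1]
  exact exists_isTangent_of_length_lt hQ₀ hγ hG h0 hlt

end Grassmann

/-! ### The CS decomposition and its tangent vector. -/

namespace Grassmann

open Set Filter Topology NormedSpace Matrix PrincipalLog

section CSDecomposition

attribute [local instance] Matrix.frobeniusNormedRing Matrix.frobeniusNormedAlgebra

variable {k m n : ℕ}

theorem rectDiag_apply (d : Fin k → ℝ) (i : Fin k) (j : Fin m) :
    rectDiag m d i j = if (i : ℕ) = (j : ℕ) then d i else 0 := rfl

/-- Extension of `d : Fin k → ℝ` to `Fin m` by a constant. -/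
def extendBy (m : ℕ) (c : ℝ) (d : Fin k → ℝ) (j : Fin m) : ℝ :=
  if h : (j : ℕ) < k then d ⟨j, h⟩ else c

theorem sum_rectDiag_right (hkm : k ≤ m) (d : Fin k → ℝ) (i : Fin k) (f : Fin m → ℝ) :
    ∑ l, rectDiag m d i l * f l = d i * f (Fin.castLE hkm i) := by
  rw [Finset.sum_eq_single (Fin.castLE hkm i)]
  · simp [rectDiag_apply]
  · intro l _ hl
    have : (i : ℕ) ≠ (l : ℕ) := fun h => hl (Fin.ext h.symm)
    simp [rectDiag_apply, this]
  · simp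

theorem sum_rectDiag_left (d : Fin k → ℝ) (j : Fin m) (f : Fin k → ℝ) :
    ∑ l, rectDiag m d l j * f l = extendBy m 0 (fun i => d i * f i) j := by
  rw [extendBy]
  split_ifs with h
  · rw [Finset.sum_eq_single ⟨j, h⟩]
    · simp [rectDiag_apply]
    · intro l _ hl
      have : (l : ℕ) ≠ (j : ℕ) := fun h => hl (Fin.ext h)
      simp [rectDiag_apply, this]
    · simp
  · refine Finset.sum_eq_zero fun l _ => ?_
    have : (l : ℕ) ≠ (j : ℕ) := fun h' => h (h' ▸ l.2)
    simp [rectDiag_apply, this]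

theorem rectDiag_mul_transpose (hkm : k ≤ m) (d e : Fin k → ℝ) :
    rectDiag m d * (rectDiag m e)ᵀ = diagonal fun i => d i * e i := by
  ext i j
  rw [mul_apply]
  simp only [transpose_apply]
  rw [sum_rectDiag_right hkm d i fun l => rectDiag m e j l, diagonal_apply, rectDiag_apply]
  by_cases h : i = j
  · subst h; simp
  · have : (j : ℕ) ≠ (i : ℕ) := fun h' => h (Fin.ext h'.symm)
    simp [h, this]

theorem transpose_rectDiag_mul (d e : Fin k → ℝ) :
    (rectDiag m d)ᵀ * rectDiag m e = diagonal (extendBy m 0 fun i => d i * e i) := by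
  ext i j
  rw [mul_apply]
  simp only [transpose_apply]
  rw [sum_rectDiag_left d i fun l => rectDiag m e l j, diagonal_apply, extendBy, extendBy]
  by_cases h : i = j
  · subst h; simp [rectDiag_apply]
  · have : (i : ℕ) ≠ (j : ℕ) := fun h' => h (Fin.ext h')
    simp [h, rectDiag_apply, this]

theorem rectDiag_mul_diagonal (d e : Fin k → ℝ) (c : ℝ) :
    rectDiag m d * diagonal (extendBy m c e) = rectDiag m fun i => d i * e i := by
  ext i j
  rw [mul_diagonal, rectDiag_apply, rectDiag_apply]
  by_cases h : (i : ℕ) = (j : ℕ)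
  · have hj : (j : ℕ) < k := h ▸ i.2
    have hi : (⟨j, hj⟩ : Fin k) = i := Fin.ext h.symm
    rw [if_pos h, if_pos h, extendBy, dif_pos hj, hi]
  · simp [h]

theorem transpose_rectDiag_mul_diagonal (d e : Fin k → ℝ) :
    (rectDiag m d)ᵀ * diagonal e = (rectDiag m fun i => d i * e i)ᵀ := by
  ext i j
  rw [mul_diagonal, transpose_apply, transpose_apply, rectDiag_apply, rectDiag_apply]
  split_ifs <;> simp

/-- The infinitesimal generator of the family `csMiddle m (t • θ)`. -/
def csGenerator (m : ℕ) (θ : Fin k → ℝ) : Matrix (Fin k ⊕ Fin m) (Fin k ⊕ Fin m) ℝ :=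
  fromBlocks 0 (rectDiag m θ) (-(rectDiag m θ)ᵀ) 0

theorem csGenerator_mul_csMiddle (hkm : k ≤ m) (θ φ : Fin k → ℝ) :
    csGenerator m θ * csMiddle m φ = fromBlocks
      (-diagonal fun i => θ i * Real.sin (φ i))
      (rectDiag m fun i => θ i * Real.cos (φ i))
      (-(rectDiag m fun i => θ i * Real.cos (φ i))ᵀ)
      (-diagonal (extendBy m 0 fun i => θ i * Real.sin (φ i))) := by
  -- The padding value is 1 = cos 0 for this block. In products of two `rectDiag` factors it is 0.
  have h : (fun j : Fin m => if h : (j : ℕ) < k then Real.cos (φ ⟨j, h⟩) else 1) =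
      extendBy m 1 fun i => Real.cos (φ i) := rfl
  rw [csGenerator, csMiddle, fromBlocks_multiply, h, rectDiag_mul_diagonal,
    Matrix.mul_neg, Matrix.neg_mul, rectDiag_mul_transpose hkm, Matrix.neg_mul,
    transpose_rectDiag_mul, transpose_rectDiag_mul_diagonal]
  simp

theorem csMiddle_zero (m : ℕ) : csMiddle m (0 : Fin k → ℝ) = 1 := by
  have h1 : rectDiag m (fun i : Fin k => Real.sin ((0 : Fin k → ℝ) i)) = 0 := by
    ext i j; simp [rectDiag_apply]
  rw [csMiddle, h1]
  simp

theorem hasDerivAt_csMiddle (hkm : k ≤ m) (θ : Fin k → ℝ) (t : ℝ) :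
    HasDerivAt (fun t : ℝ => csMiddle m (t • θ)) (csGenerator m θ * csMiddle m (t • θ)) t := by
  have hs : ∀ i, HasDerivAt (fun t : ℝ => Real.sin ((t • θ) i))
      (θ i * Real.cos ((t • θ) i)) t := fun i => by
    refine (((hasDerivAt_id t).mul_const (θ i)).sin).congr_deriv ?_
    simp only [id, one_mul, Pi.smul_apply, smul_eq_mul]; ring
  have hc : ∀ i, HasDerivAt (fun t : ℝ => Real.cos ((t • θ) i))
      (-(θ i * Real.sin ((t • θ) i))) t := fun i => by
    refine (((hasDerivAt_id t).mul_const (θ i)).cos).congr_deriv ?_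
    simp only [id, one_mul, Pi.smul_apply, smul_eq_mul]; ring
  rw [csGenerator_mul_csMiddle hkm]
  refine hasDerivAt_of_apply fun a b => ?_
  rcases a with i | i <;> rcases b with j | j
  · simp only [csMiddle, fromBlocks_apply₁₁, diagonal_apply, Matrix.neg_apply]
    split_ifs
    · exact hc i
    · rw [neg_zero]; exact hasDerivAt_const t _
  · simp only [csMiddle, fromBlocks_apply₁₂, rectDiag_apply]
    split_ifs
    · exact hs i
    · exact hasDerivAt_const t _
  · simp only [csMiddle, fromBlocks_apply₂₁, Matrix.neg_apply, transpose_apply, rectDiag_apply]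
    split_ifs
    · exact (hs j).neg
    · rw [neg_zero]; exact hasDerivAt_const t _
  · simp only [csMiddle, fromBlocks_apply₂₂, diagonal_apply, Matrix.neg_apply, extendBy]
    split_ifs
    · exact hc _
    · rw [neg_zero]; exact hasDerivAt_const t _
    · rw [neg_zero]; exact hasDerivAt_const t _

/-- Moving the signature past one factor C turns C I Cᵀ into C² I. This squaring doubles the angles
and explains the 2 in B. -/
theorem csMiddle_mul_signature (θ : Fin k → ℝ) :
    csMiddle m θ * signature k m = signature k m * (csMiddle m θ)ᵀ := by
  rw [csMiddle, signature, fromBlocks_multiply, fromBlocks_transpose, fromBlocks_multiply]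
  simp

theorem fromBlocks_signature_transpose {U : Matrix (Fin k) (Fin k) ℝ} {V : Matrix (Fin m) (Fin m) ℝ}
    (hU : U * Uᵀ = 1) (hV : V * Vᵀ = 1) :
    fromBlocks U 0 0 V * signature k m * (fromBlocks U 0 0 V)ᵀ = signature k m := by
  rw [signature, fromBlocks_multiply, fromBlocks_transpose, fromBlocks_multiply]
  simp [hU, hV]

variable {G : Matrix (Fin n) (Fin k ⊕ Fin m) ℝ}

/-- Conjugation by a rectangular matrix as a continuous linear map. -/
noncomputable def conjCLM (G : Matrix (Fin n) (Fin k ⊕ Fin m) ℝ) :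
    Matrix (Fin k ⊕ Fin m) (Fin k ⊕ Fin m) ℝ →L[ℝ] Matrix (Fin n) (Fin n) ℝ :=
  LinearMap.toContinuousLinearMap
    { toFun := fun X => G * X * Gᵀ
      map_add' := fun X Y => by rw [Matrix.mul_add, Matrix.add_mul]
      map_smul' := fun c X => by simp }

theorem conj_mul_conj (hG : Gᵀ * G = 1) (X Y : Matrix (Fin k ⊕ Fin m) (Fin k ⊕ Fin m) ℝ) :
    G * X * Gᵀ * (G * Y * Gᵀ) = G * (X * Y) * Gᵀ := by
  calc G * X * Gᵀ * (G * Y * Gᵀ) = G * X * (Gᵀ * G) * Y * Gᵀ := by simp only [Matrix.mul_assoc]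
    _ = G * (X * Y) * Gᵀ := by rw [hG, Matrix.mul_one, Matrix.mul_assoc G]

theorem exp_csGenerator (hkm : k ≤ m) (hG : Gᵀ * G = 1) (hG' : G * Gᵀ = 1) (θ : Fin k → ℝ) :
    exp (G * csGenerator m θ * Gᵀ) = G * csMiddle m θ * Gᵀ := by
  have hd : ∀ t : ℝ, HasDerivAt (fun t : ℝ => G * csMiddle m (t • θ) * Gᵀ)
      (G * (csGenerator m θ * csMiddle m (t • θ)) * Gᵀ) t := fun t =>
    (conjCLM G).hasFDerivAt.comp_hasDerivAt t (hasDerivAt_csMiddle hkm θ t)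
  have h := eq_of_hasDerivAt_zero (f := fun t : ℝ => exp (t • -(G * csGenerator m θ * Gᵀ)) *
      (G * csMiddle m (t • θ) * Gᵀ)) fun t _ => by
    refine ((hasDerivAt_exp_smul_const (-(G * csGenerator m θ * Gᵀ)) t).mul (hd t)).congr_deriv ?_
    rw [← conj_mul_conj hG]
    noncomm_ring
  simp only [one_smul, zero_smul, exp_zero, csMiddle_zero, Matrix.mul_one, hG'] at h
  calc exp (G * csGenerator m θ * Gᵀ) = exp (G * csGenerator m θ * Gᵀ) *
        (exp (-(G * csGenerator m θ * Gᵀ)) * (G * csMiddle m θ * Gᵀ)) := by rw [h, mul_one]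
    _ = _ := by rw [← mul_assoc, exp_mul_exp_neg, one_mul]

theorem exp_two_smul_csGenerator (hkm : k ≤ m) (hG : Gᵀ * G = 1) (hG' : G * Gᵀ = 1)
    (θ : Fin k → ℝ) :
    exp ((2 : ℝ) • (G * csGenerator m θ * Gᵀ)) = G * (csMiddle m θ * csMiddle m θ) * Gᵀ := by
  rw [two_smul, Matrix.exp_add_of_commute _ _ (Commute.refl _), exp_csGenerator hkm hG hG',
    conj_mul_conj hG]

/-- The tangent vector with principal angles `θ` in the frame `G`. -/
def csTangent (G : Matrix (Fin n) (Fin k ⊕ Fin m) ℝ) (θ : Fin k → ℝ) :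
    Matrix (Fin n) (Fin n) ℝ :=
  G * fromBlocks 0 ((-2 : ℝ) • rectDiag m θ) ((-2 : ℝ) • rectDiag m θ)ᵀ 0 * Gᵀ

theorem csTangent_mul (hG : Gᵀ * G = 1) (θ : Fin k → ℝ) :
    csTangent G θ * (G * signature k m * Gᵀ) = (2 : ℝ) • (G * csGenerator m θ * Gᵀ) := by
  rw [csTangent, conj_mul_conj hG, signature, fromBlocks_multiply, csGenerator,
    ← Matrix.smul_mul, ← Matrix.mul_smul, fromBlocks_smul]
  congr 3 <;> simp

theorem isTangent_csTangent (hG : Gᵀ * G = 1) (θ : Fin k → ℝ) :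
    IsTangent (G * signature k m * Gᵀ) (csTangent G θ) := by
  constructor
  · rw [csTangent, transpose_mul, transpose_mul, transpose_transpose, fromBlocks_transpose,
      transpose_transpose, transpose_zero, transpose_zero, Matrix.mul_assoc]
  · rw [csTangent, conj_mul_conj hG, conj_mul_conj hG, signature, fromBlocks_multiply,
      fromBlocks_multiply, ← Matrix.neg_mul, ← Matrix.mul_neg, fromBlocks_neg]
    congr 3 <;> simp

theorem csTangent_mul_self (hkm : k ≤ m) (hG : Gᵀ * G = 1) (θ : Fin k → ℝ) :
    csTangent G θ * csTangent G θ = G * (diagonal (Sum.elim (fun i => 4 * θ i ^ 2)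
      (extendBy m 0 fun i => 4 * θ i ^ 2))) * Gᵀ := by
  have h1 : (diagonal fun i => 4 * θ i ^ 2) = (4 : ℝ) • diagonal fun i => θ i * θ i := by
    rw [← diagonal_smul]; congr 1; ext i; simp [sq]
  have h2 : diagonal (extendBy m 0 fun i => 4 * θ i ^ 2) =
      (4 : ℝ) • diagonal (extendBy m 0 fun i => θ i * θ i) := by
    rw [← diagonal_smul]; congr 1; ext i
    simp only [extendBy, Pi.smul_apply, smul_eq_mul]
    split_ifs <;> simp [sq]
  rw [csTangent, conj_mul_conj hG, fromBlocks_multiply, ← fromBlocks_diagonal, h1, h2,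
    ← rectDiag_mul_transpose hkm, ← transpose_rectDiag_mul]
  congr 3 <;> simp [smul_smul] <;> norm_num

/-- The square of `csTangent` is orthogonally conjugate to a diagonal matrix with entries 4θᵢ² or 0,
all at most π². Each d i² is an average of these entries, weighted by the squares in a column of
GᵀO. Equality is possible, since θᵢ = π/2 is allowed. -/
theorem abs_eigenvalue_csTangent_le_pi (hkm : k ≤ m) (hG : Gᵀ * G = 1) (hG' : G * Gᵀ = 1)
    {θ : Fin k → ℝ} (hθ : ∀ i, θ i ∈ Icc 0 (Real.pi / 2)) {O : Matrix (Fin n) (Fin n) ℝ}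
    {d : Fin n → ℝ} (hO1 : Oᵀ * O = 1) (hO : csTangent G θ * O = O * diagonal d) (i : Fin n) :
    |d i| ≤ Real.pi := by
  set e : Fin k ⊕ Fin m → ℝ := Sum.elim (fun i => 4 * θ i ^ 2) (extendBy m 0 fun i => 4 * θ i ^ 2)
    with he
  have hθ2 : ∀ i, 4 * θ i ^ 2 ≤ Real.pi ^ 2 := fun i => by
    have h1 := (hθ i).1
    have h2 := (hθ i).2
    nlinarith
  have hle : ∀ j, e j ≤ Real.pi ^ 2 := by
    rintro (j | j)
    · exact hθ2 j
    · simp only [he, Sum.elim_inr, extendBy]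
      split_ifs
      · exact hθ2 _
      · positivity
  set H : Matrix (Fin k ⊕ Fin m) (Fin n) ℝ := Gᵀ * O with hH
  have hHH : Hᵀ * H = 1 := by
    rw [hH, transpose_mul, transpose_transpose, Matrix.mul_assoc, ← Matrix.mul_assoc G, hG',
      Matrix.one_mul, hO1]
  have hd : diagonal (fun i => d i * d i) = Hᵀ * diagonal e * H := by
    have h1 : Oᵀ * (csTangent G θ * csTangent G θ) * O = diagonal fun i => d i * d i := by
      rw [← diagonal_mul_diagonal, Matrix.mul_assoc, Matrix.mul_assoc, hO,
        ← Matrix.mul_assoc (csTangent G θ), hO, ← Matrix.mul_assoc, ← Matrix.mul_assoc, hO1,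
        Matrix.one_mul]
    rw [← h1, csTangent_mul_self hkm hG, ← he, hH, transpose_mul, transpose_transpose]
    simp only [Matrix.mul_assoc]
  have h2 : d i * d i = ∑ j, e j * H j i ^ 2 := by
    have h3 := congrFun (congrFun hd i) i
    rw [diagonal_apply_eq, Matrix.mul_apply] at h3
    rw [h3]
    refine Finset.sum_congr rfl fun j _ => ?_
    rw [mul_diagonal, transpose_apply]; ring
  have h4 : ∑ j, H j i ^ 2 = 1 := by
    have h3 := congrFun (congrFun hHH i) i
    rw [one_apply_eq, Matrix.mul_apply] at h3
    rw [← h3]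
    exact Finset.sum_congr rfl fun j _ => by rw [transpose_apply, sq]
  have h5 : d i * d i ≤ Real.pi ^ 2 := by
    rw [h2, ← mul_one (Real.pi ^ 2), ← h4, Finset.mul_sum]
    exact Finset.sum_le_sum fun j _ => mul_le_mul_of_nonneg_right (hle j) (sq_nonneg _)
  rw [← sq] at h5
  exact abs_le_of_sq_le_sq h5 Real.pi_pos.le

/-- If `Q₁` is the exponential of a short tangent vector, then that vector is the one given by the
principal angles. -/
theorem eq_csTangent (hkm : k ≤ m) (hG : Gᵀ * G = 1) (hG' : G * Gᵀ = 1)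
    {θ : Fin k → ℝ} (hθ : ∀ i, θ i ∈ Icc 0 (Real.pi / 2)) {k' : ℕ}
    {Q X : Matrix (Fin n) (Fin n) ℝ} (hQ : Q ∈ Gr k' n) (hQG : Q = G * signature k m * Gᵀ)
    (hX : IsTangent Q X) (hnorm : ‖X‖ < Real.sqrt 2 * Real.pi)
    (hexp : exp (X * Q) * Q = G * (csMiddle m θ * csMiddle m θ) * Gᵀ * Q) : X = csTangent G θ := by
  have hQQ := mul_self_of_mem_Gr hQ
  have hT : IsTangent Q (csTangent G θ) := hQG ▸ isTangent_csTangent hG θ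
  have hcancel : ∀ {A B : Matrix (Fin n) (Fin n) ℝ}, A * Q = B * Q → A = B := fun {A B} h => by
    rw [← mul_one A, ← hQQ, ← mul_assoc, h, mul_assoc, hQQ, mul_one]
  have h1 : exp (csTangent G θ * Q) = G * (csMiddle m θ * csMiddle m θ) * Gᵀ := by
    rw [hQG, csTangent_mul hG, exp_two_smul_csGenerator hkm hG hG']
  have h2 : exp (X * Q) = exp (csTangent G θ * Q) := by rw [h1]; exact hcancel hexp
  have hdom := hX.exp_mem_domain_of_norm_lt hQ hnorm
  rw [h2] at hdom
  obtain ⟨O, d, hO1, hO2, hO⟩ := exists_orthogonal_diagonalization hT.1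
  -- The short vector X has already placed the common exponential in `domain`, which upgrades ≤ π to
  -- < π.
  have h3 := hT.plog_exp hQ hO1 hO2 hO fun i =>
    lt_of_le_of_ne (abs_eigenvalue_csTangent_le_pi hkm hG hG' hθ hO1 hO i)
      (hT.abs_eigenvalue_ne_pi hQ hO1 hO2 hO hdom i)
  refine hcancel ?_
  rw [← h3, ← h2, hX.plog_exp_of_norm_lt hQ hnorm]

end CSDecomposition

end Grassmann

/-! ### Assembly in the frame V₀ diag(U, V). -/

theorem corollary4p6 (k n : ℕ) (hk : 1 ≤ k) (hkn : 2 * k ≤ n)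
    (Q₀ Q₁ : Matrix (Fin n) (Fin n) ℝ)
    (hQ₀ : Q₀ ∈ Grassmann.Gr k n) (hQ₁ : Q₁ ∈ Grassmann.Gr k n)
    (hd : Grassmann.geodesicDist k n Q₀ Q₁ < ENNReal.ofReal (Real.sqrt 2 * Real.pi))
    (V₀ V₁ : Matrix (Fin n) (Fin k ⊕ Fin (n - k)) ℝ)
    (hV₀ : Grassmann.IsEigendecomposition Q₀ V₀)
    (hV₁ : Grassmann.IsEigendecomposition Q₁ V₁)
    (U W : Matrix (Fin k) (Fin k) ℝ) (V Z : Matrix (Fin (n - k)) (Fin (n - k)) ℝ)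
    (hU : U ∈ Matrix.orthogonalGroup (Fin k) ℝ) (hW : W ∈ Matrix.orthogonalGroup (Fin k) ℝ)
    (hV : V ∈ Matrix.orthogonalGroup (Fin (n - k)) ℝ)
    (hZ : Z ∈ Matrix.orthogonalGroup (Fin (n - k)) ℝ)
    (θ : Fin k → ℝ) (hθ : ∀ i, θ i ∈ Set.Icc 0 (Real.pi / 2))
    (hcs : V₀ᵀ * V₁ = Matrix.fromBlocks U 0 0 V * Grassmann.csMiddle (n - k) θ *
      (Matrix.fromBlocks W 0 0 Z)ᵀ)
    (B : Matrix (Fin k) (Fin (n - k)) ℝ)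
    (hB : B = (-2 : ℝ) • (U * Grassmann.rectDiag (n - k) θ * Vᵀ)) :
    Q₁ ∈ Grassmann.logDomain k n Q₀ ∧
      Grassmann.logMap k n Q₀ Q₁ = V₀ * Matrix.fromBlocks 0 B Bᵀ 0 * V₀ᵀ := by
  have horth : ∀ {l : ℕ} {A : Matrix (Fin l) (Fin l) ℝ}, A ∈ Matrix.orthogonalGroup (Fin l) ℝ →
      A * Aᵀ = 1 ∧ Aᵀ * A = 1 := fun hA =>
    ⟨(Matrix.mem_orthogonalGroup_iff _ _).1 hA, (Matrix.mem_orthogonalGroup_iff' _ _).1 hA⟩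
  have hkm : k ≤ n - k := by omega
  set D := Matrix.fromBlocks U 0 0 V with hD
  set E := Matrix.fromBlocks W 0 0 Z with hE
  have hDD : D * Dᵀ = 1 := by
    rw [hD, Matrix.fromBlocks_transpose, Matrix.fromBlocks_multiply]
    simp [(horth hU).1, (horth hV).1]
  have hDD' : Dᵀ * D = 1 := by
    rw [hD, Matrix.fromBlocks_transpose, Matrix.fromBlocks_multiply]
    simp [(horth hU).2, (horth hV).2]
  have hDs := Grassmann.fromBlocks_signature_transpose (horth hU).1 (horth hV).1
  have hEs := Grassmann.fromBlocks_signature_transpose (U := Wᵀ) (V := Zᵀ)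
    (by simpa using (horth hW).2) (by simpa using (horth hZ).2)
  have hEt : Matrix.fromBlocks Wᵀ 0 0 Zᵀ = Eᵀ := by rw [hE, Matrix.fromBlocks_transpose]; simp
  rw [hEt, Matrix.transpose_transpose] at hEs
  rw [← hD] at hDs
  obtain ⟨hV01, hV02, hV03⟩ := hV₀
  obtain ⟨-, -, hV13⟩ := hV₁
  set G := V₀ * D with hGdef
  have hGt : Gᵀ = Dᵀ * V₀ᵀ := Matrix.transpose_mul _ _
  have hG : Gᵀ * G = 1 := by
    rw [hGt, hGdef, Matrix.mul_assoc, ← Matrix.mul_assoc V₀ᵀ, hV01, Matrix.one_mul, hDD']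
  have hG' : G * Gᵀ = 1 := by
    rw [hGt, hGdef, Matrix.mul_assoc, ← Matrix.mul_assoc D, hDD, Matrix.one_mul, hV02]
  have hQG : Q₀ = G * Grassmann.signature k (n - k) * Gᵀ := by
    calc Q₀ = V₀ * (D * Grassmann.signature k (n - k) * Dᵀ) * V₀ᵀ := by rw [hDs, hV03]
      _ = G * Grassmann.signature k (n - k) * Gᵀ := by
        rw [hGt, hGdef]; simp only [Matrix.mul_assoc]
  have hV1 : V₁ = G * Grassmann.csMiddle (n - k) θ * Eᵀ := by
    rw [hGdef, Matrix.mul_assoc V₀, Matrix.mul_assoc V₀, ← hcs, ← Matrix.mul_assoc, hV02,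
      Matrix.one_mul]
  have hQ1G : Q₁ = G * (Grassmann.csMiddle (n - k) θ * Grassmann.csMiddle (n - k) θ) * Gᵀ * Q₀ := by
    rw [hQG, Grassmann.conj_mul_conj hG, Matrix.mul_assoc (Grassmann.csMiddle (n - k) θ),
      Grassmann.csMiddle_mul_signature, hV13, hV1]
    -- The factor diag(W, Z) preserves the signature under conjugation, so it drops out of Q₁.
    nth_rw 2 [← hEs]
    simp only [Matrix.transpose_mul, Matrix.transpose_transpose, Matrix.mul_assoc]
  obtain ⟨X, hX, hXn, hX1⟩ := Grassmann.exists_isTangent_of_geodesicDist_lt hQ₀ hd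
  have hXeq := Grassmann.eq_csTangent hkm hG hG' hθ hQ₀ hQG hX hXn (hX1.trans hQ1G)
  have hXB : X = V₀ * Matrix.fromBlocks 0 B Bᵀ 0 * V₀ᵀ := by
    have h1 : D * Matrix.fromBlocks 0 ((-2 : ℝ) • Grassmann.rectDiag (n - k) θ)
        ((-2 : ℝ) • Grassmann.rectDiag (n - k) θ)ᵀ 0 * Dᵀ = Matrix.fromBlocks 0 B Bᵀ 0 := by
      rw [hD, Matrix.fromBlocks_transpose, Matrix.fromBlocks_multiply, Matrix.fromBlocks_multiply,
        hB]
      simp [Matrix.mul_assoc]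
    rw [hXeq, Grassmann.csTangent, ← h1, hGt, hGdef]
    simp only [Matrix.mul_assoc]
  rw [← hXB, ← hX1]
  exact Grassmann.log_of_norm_lt hQ₀ hX hXn
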